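/- Work in homotopy type theory: intensional dependent type theory with cumulative universes $\mathcal U_0:\mathcal U_1:\cdots$, $\Pi$-, $\Sigma$- and identity types, function extensionality, univalence, and the higher inductive types used below (with their dependent induction principles, which compute definitionally on point constructors and up to identification on path constructors). Let $\mathcal U$ be any of the universes and let $A:\mathcal U$. The *free $\infty$-group* $\mathbf F(A)$ is the higher inductive type with constructors $\mathsf{unit}:\mathbf F(A)$; $\mathsf{cons},\mathsf{icons}:A\to\mathbf F(A)\to\mathbf F(A)$; and, for all $a:A$ and $x:\mathbf F(A)$, $$\mu_1(a,x):\mathsf{icons}_a(\mathsf{cons}_a(x))=x,\qquad \mu_2(a,x):\mathsf{cons}_a(\mathsf{icons}_a(x))=x,\qquad \mu(a,x):\mathsf{ap}_{\mathsf{cons}_a}(\mu_1(a,x))=\mu_2(a,\mathsf{cons}_a(x)),$$ so that each $\mathsf{cons}_a$ is a half-adjoint equivalence. The *wedge of $A$-many circles* $\mathsf W(A)$ is the higher inductive type with constructors $\mathsf N:\mathsf W(A)$ and $\mathsf{loops}:A\to(\mathsf N=\mathsf N)$. A type $G$ is an *$\infty$-group with delooping $(X,x)$* if $X$ is a connected type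 (its set truncation is contractible), $x:X$, and there is given an equivalence $G\simeq(x=x)$. Then, for every $A:\mathcal U$, the type $\mathbf F(A)$ is an $\infty$-group with delooping $(\mathsf W(A),\mathsf N)$: the type $\mathsf W(A)$ is connected and there is an equivalence $e:\mathbf F(A)\simeq(\mathsf N=_{\mathsf W(A)}\mathsf N)$. Moreover $e$ respects the structure: $e(\mathsf{unit})=\mathsf{refl}_{\mathsf N}$, and $e(\mathsf{cons}_a(x))=\mathsf{loops}(a)\cdot e(x)$ for all $a:A$ and $x:\mathbf F(A)$, where $\cdot$ is concatenation of identifications. That is, for each universe $\mathcal U$, type theory has a closed term whose type expresses this statement for all $A:\mathcal U$. -/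

import Mathlib

/-!
Homotopy type theory as a formal system: dependent type theory with a cumulative tower of
universes, dependent products, dependent sums, identity types, function extensionality,
univalence, and three higher inductive types: the free higher group `F A`, the wedge of circles
`W A`, and the set truncation. Terms are built from variables, universes, products, abstractions,
applications and primitive constants; each constant has a closed type, and the eliminators have
defining equations. A statement of type theory is established by a closed term of the
corresponding type.
-/

namespace HoTT

/-- The primitive constants. The numbers are universe levels: `i` is the level of the types that
the constant is about, `j` is the level of the motive of an eliminator. -/
inductive Cst : Type
  -- dependent sums
  | sig (i : ℕ) | pair (i : ℕ) | sigElim (i j : ℕ)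
  -- identity types
  | id (i : ℕ) | refl (i : ℕ) | idElim (i j : ℕ)
  -- axioms
  | funext (i : ℕ) | univalence (i : ℕ)
  -- the free higher group
  | free (i : ℕ) | unit (i : ℕ) | cons (i : ℕ) | icons (i : ℕ)
  | mu1 (i : ℕ) | mu2 (i : ℕ) | mu (i : ℕ)
  | freeElim (i j : ℕ)
  | freeElimMu1 (i j : ℕ) | freeElimMu2 (i j : ℕ) | freeElimMu (i j : ℕ)
  -- the wedge of circles
  | wedge (i : ℕ) | north (i : ℕ) | loops (i : ℕ)
  | wedgeElim (i j : ℕ) | wedgeElimLoops (i j : ℕ)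
  -- the set truncation
  | trunc (i : ℕ) | truncIn (i : ℕ) | truncSet (i : ℕ) | truncElim (i j : ℕ)
  deriving DecidableEq

/-- Raw terms, with de Bruijn indices for variables. In `pi A B` and `lam b` the terms `B` and
`b` are in the scope of one more variable, which has index `0` there. -/
inductive Tm : Type
  | var (n : ℕ)
  | univ (i : ℕ)
  | pi (A B : Tm)
  | lam (b : Tm)
  | app (f a : Tm)
  | cst (c : Cst)
  deriving DecidableEq

/-- Add `d` to all variables of index at least `k`. -/
def Tm.lift : Tm → (d k : ℕ) → Tm
  | .var n, d, k => if n < k then .var n else .var (n + d)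
  | .univ i, _, _ => .univ i
  | .pi A B, d, k => .pi (A.lift d k) (B.lift d (k + 1))
  | .lam b, d, k => .lam (b.lift d (k + 1))
  | .app f a, d, k => .app (f.lift d k) (a.lift d k)
  | .cst c, _, _ => .cst c

/-- Replace the variable of index `k` by `s` (which lives outside of the `k` innermost binders),
and lower the variables of larger index by one. -/
def Tm.subst : Tm → (s : Tm) → (k : ℕ) → Tm
  | .var n, s, k => if n < k then .var n else if n = k then s.lift k 0 else .var (n - 1)
  | .univ i, _, _ => .univ i
  | .pi A B, s, k => .pi (A.subst s k) (B.subst s (k + 1))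
  | .lam b, s, k => .lam (b.subst s (k + 1))
  | .app f a, s, k => .app (f.subst s k) (a.subst s k)
  | .cst c, _, _ => .cst c

/-! ### Writing terms with named variables

A `Raw` gives a term for every number of variables in scope; binders are written with Lean
functions, and `close` gives the resulting closed term. -/

/-- A term with named variables, as a function of the number of binders around it. -/
abbrev Raw : Type := ℕ → Tm

/-- The bound variable introduced by the binder that has `n` binders around it. -/
def bvar (n : ℕ) : Raw := fun m => .var (m - (n + 1))

/-- The universe of level `i`. -/
def U (i : ℕ) : Raw := fun _ => .univ i

/-- The dependent product of `B x` over `x : A`. -/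
def pi (A : Raw) (B : Raw → Raw) : Raw := fun n => .pi (A n) (B (bvar n) (n + 1))

/-- The function that sends `x` to `b x`. -/
def lam (b : Raw → Raw) : Raw := fun n => .lam (b (bvar n) (n + 1))

/-- Application. -/
def app (f a : Raw) : Raw := fun n => .app (f n) (a n)

/-- A constant. -/
def cst (c : Cst) : Raw := fun _ => .cst c

/-- The function type. -/
def arr (A B : Raw) : Raw := pi A fun _ => B

/-- The closed term that is described by a `Raw`. -/
def close (t : Raw) : Tm := t 0

infixl:75 " ⬝ " => app
infixr:60 " ⇒ " => arr

/-! ### Abbreviations for constants and derived notions -/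

/-- The dependent sum of the family `B`. -/
def Sig (i : ℕ) (A : Raw) (B : Raw → Raw) : Raw := cst (.sig i) ⬝ A ⬝ lam B

/-- The product of two types. -/
def Times (i : ℕ) (A B : Raw) : Raw := Sig i A fun _ => B

/-- The pair `(a, b)` in `Sig i A B`. -/
def pair (i : ℕ) (A : Raw) (B : Raw → Raw) (a b : Raw) : Raw :=
  cst (.pair i) ⬝ A ⬝ lam B ⬝ a ⬝ b

/-- The first projection of `p : Sig i A B`. -/
def pr1 (i : ℕ) (A : Raw) (B : Raw → Raw) (p : Raw) : Raw :=
  cst (.sigElim i i) ⬝ A ⬝ lam B ⬝ (lam fun _ => A) ⬝ (lam fun a => lam fun _ => a) ⬝ p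

/-- The second projection of `p : Times i A B`. -/
def snd (i : ℕ) (A B p : Raw) : Raw :=
  cst (.sigElim i i) ⬝ A ⬝ (lam fun _ => B) ⬝ (lam fun _ => B) ⬝
    (lam fun _ => lam fun b => b) ⬝ p

/-- The identity type `x =_A y`. -/
def Id (i : ℕ) (A x y : Raw) : Raw := cst (.id i) ⬝ A ⬝ x ⬝ y

/-- Reflexivity at `x : A`. -/
def refl (i : ℕ) (A x : Raw) : Raw := cst (.refl i) ⬝ A ⬝ x

/-- Path induction based at `a`, for a family `C b p` indexed by `p : a = b`. -/
def idElim (i j : ℕ) (A a : Raw) (C : Raw → Raw → Raw) (c b p : Raw) : Raw :=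
  cst (.idElim i j) ⬝ A ⬝ a ⬝ (lam fun b => lam fun p => C b p) ⬝ c ⬝ b ⬝ p

/-- Transport of `u : P x` along `p : x =_A y`, for a family `P` of types over `A`. -/
def transport (i j : ℕ) (A : Raw) (P : Raw → Raw) (x y p u : Raw) : Raw :=
  idElim i j A x (fun z _ => P z) u y p

/-- The action of a function `f` from `A` to `B` on `p : x =_A y`. -/
def ap (i j : ℕ) (A B : Raw) (f : Raw → Raw) (x y p : Raw) : Raw :=
  idElim i j A x (fun z _ => Id j B (f x) (f z)) (refl j B (f x)) y p

/-- The action of a dependent function `f` from `A` to the family `P` on `p : x =_A y`; its type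
is `transport p (f x) = f y`. -/
def apd (i j : ℕ) (A : Raw) (P f : Raw → Raw) (x y p : Raw) : Raw :=
  idElim i j A x (fun z q => Id j (P z) (transport i j A P x z q (f x)) (f z))
    (refl j (P x) (f x)) y p

/-- The concatenation of `p : x =_A y` and `q : y =_A z`. -/
def concat (i : ℕ) (A x y z p q : Raw) : Raw :=
  idElim i i A x (fun w _ => Id i A w z ⇒ Id i A x z) (lam fun r => r) y p ⬝ q

/-- `f : A → B` is an equivalence: it has a half-adjoint inverse. -/
def IsEquiv (i : ℕ) (A B f : Raw) : Raw :=
  Sig i (B ⇒ A) fun g =>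
  Sig i (pi A fun x => Id i A (g ⬝ (f ⬝ x)) x) fun η =>
  Sig i (pi B fun y => Id i B (f ⬝ (g ⬝ y)) y) fun ε =>
  pi A fun x => Id i (Id i B (f ⬝ (g ⬝ (f ⬝ x))) (f ⬝ x))
    (ap i i A B (f ⬝ ·) (g ⬝ (f ⬝ x)) x (η ⬝ x)) (ε ⬝ (f ⬝ x))

/-- The type of equivalences from `A` to `B`. -/
def Equiv (i : ℕ) (A B : Raw) : Raw := Sig i (A ⇒ B) fun f => IsEquiv i A B f

/-- The map underlying an equivalence. -/
def Equiv.map (i : ℕ) (A B e : Raw) : Raw := pr1 i (A ⇒ B) (fun f => IsEquiv i A B f) e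

/-- The identity equivalence of `A`. -/
def Equiv.idEquiv (i : ℕ) (A : Raw) : Raw :=
  let r : Raw := lam fun x => refl i A x
  pair i (A ⇒ A) (fun f => IsEquiv i A A f) (lam fun x => x) <|
  pair i (A ⇒ A) (fun g =>
    Sig i (pi A fun x => Id i A (g ⬝ x) x) fun η =>
    Sig i (pi A fun y => Id i A (g ⬝ y) y) fun ε =>
    pi A fun x => Id i (Id i A (g ⬝ x) x) (ap i i A A (fun z => z) (g ⬝ x) x (η ⬝ x)) (ε ⬝ x))
    (lam fun x => x) <|
  pair i (pi A fun x => Id i A x x) (fun η =>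
    Sig i (pi A fun y => Id i A y y) fun ε =>
    pi A fun x => Id i (Id i A x x) (ap i i A A (fun z => z) x x (η ⬝ x)) (ε ⬝ x)) r <|
  pair i (pi A fun y => Id i A y y) (fun ε =>
    pi A fun x => Id i (Id i A x x) (ap i i A A (fun z => z) x x (refl i A x)) (ε ⬝ x)) r
    (lam fun x => refl i (Id i A x x) (refl i A x))

/-- The map from identifications `A = B` in the universe `U i` to equivalences, as a partial
application of path induction. -/
def idToEquiv (i : ℕ) (A B : Raw) : Raw :=
  cst (.idElim (i + 1) i) ⬝ U i ⬝ A ⬝ (lam fun X => lam fun _ => Equiv i A X) ⬝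
    Equiv.idEquiv i A ⬝ B

/-- The map from identifications `f = g` of dependent functions to homotopies, as a partial
application of path induction. -/
def happly (i : ℕ) (A B f g : Raw) : Raw :=
  cst (.idElim i i) ⬝ (pi A fun x => B ⬝ x) ⬝ f ⬝
    (lam fun h => lam fun _ => pi A fun x => Id i (B ⬝ x) (f ⬝ x) (h ⬝ x)) ⬝
    (lam fun x => refl i (B ⬝ x) (f ⬝ x)) ⬝ g

/-- `A` is contractible. -/
def IsContr (i : ℕ) (A : Raw) : Raw := Sig i A fun c => pi A fun x => Id i A c x

/-- `A` is a set. -/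
def IsSet (i : ℕ) (A : Raw) : Raw :=
  pi A fun x => pi A fun y => pi (Id i A x y) fun p => pi (Id i A x y) fun q =>
  Id i (Id i A x y) p q

/-- The set truncation of `A`. -/
def Trunc (i : ℕ) (A : Raw) : Raw := cst (.trunc i) ⬝ A

/-- `A` is connected: its set truncation is contractible. -/
def IsConnected (i : ℕ) (A : Raw) : Raw := IsContr i (Trunc i A)

/-- The free higher group `F(A)`. -/
def F (i : ℕ) (A : Raw) : Raw := cst (.free i) ⬝ A

/-- The neutral element of `F(A)`. -/
def unit (i : ℕ) (A : Raw) : Raw := cst (.unit i) ⬝ A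

/-- The function `cons_a` on `F(A)`. -/
def cons (i : ℕ) (A a : Raw) : Raw := cst (.cons i) ⬝ A ⬝ a

/-- The function `icons_a` on `F(A)`. -/
def icons (i : ℕ) (A a : Raw) : Raw := cst (.icons i) ⬝ A ⬝ a

/-- `mu1 a x : icons_a (cons_a x) = x`. -/
def mu1 (i : ℕ) (A a x : Raw) : Raw := cst (.mu1 i) ⬝ A ⬝ a ⬝ x

/-- `mu2 a x : cons_a (icons_a x) = x`. -/
def mu2 (i : ℕ) (A a x : Raw) : Raw := cst (.mu2 i) ⬝ A ⬝ a ⬝ x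

/-- `mu a x : ap cons_a (mu1 a x) = mu2 a (cons_a x)`. -/
def mu (i : ℕ) (A a x : Raw) : Raw := cst (.mu i) ⬝ A ⬝ a ⬝ x

/-- `ap cons_a (mu1 a x)`, an identification `cons_a (icons_a (cons_a x)) = cons_a x`. -/
def apConsMu1 (i : ℕ) (A a x : Raw) : Raw :=
  ap i i (F i A) (F i A) (cons i A a ⬝ ·) (icons i A a ⬝ (cons i A a ⬝ x)) x (mu1 i A a x)

/-- The wedge `W(A)` of `A`-many circles. -/
def W (i : ℕ) (A : Raw) : Raw := cst (.wedge i) ⬝ A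

/-- The base point `N` of `W(A)`. -/
def north (i : ℕ) (A : Raw) : Raw := cst (.north i) ⬝ A

/-- The loop at the base point of `W(A)` with index `a : A`. -/
def loops (i : ℕ) (A a : Raw) : Raw := cst (.loops i) ⬝ A ⬝ a

/-- The loop space of `W(A)` at its base point. -/
def loopSpace (i : ℕ) (A : Raw) : Raw := Id i (W i A) (north i A) (north i A)

/-! ### Auxiliary notions for the induction principle of the free higher group -/

/-- Let `P : X → U j`, let `k : X → X`, and let `h z : P z → P (k z)` for all `z : X`. Given
`q : x = z`, the type of the functions that turn, for `v : P z`, an identification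
`transport q u = v` into an identification `transport (ap k q) (h x u) = h z v`. -/
def ApOverTy (i j : ℕ) (X P k h x u z q : Raw) : Raw :=
  pi (P ⬝ z) fun v => Id j (P ⬝ z) (transport i j X (P ⬝ ·) x z q u) v ⇒
    Id j (P ⬝ (k ⬝ z))
      (transport i j X (P ⬝ ·) (k ⬝ x) (k ⬝ z) (ap i i X X (k ⬝ ·) x z q) (h ⬝ x ⬝ u)) (h ⬝ z ⬝ v)

/-- The action of `h z : P z → P (k z)` on an identification `r : transport q u = v` over
`q : x = z`, by path induction on `q`. -/
def apOver (i j : ℕ) (X P k h x u z q v r : Raw) : Raw :=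
  idElim i j X x (fun z q => ApOverTy i j X P k h x u z q)
    (lam fun v => lam fun r => ap j j (P ⬝ x) (P ⬝ (k ⬝ x)) (h ⬝ x ⬝ ·) u v r) z q ⬝ v ⬝ r

/-- If the dependent function `f` satisfies `f (k z) ≡ h z (f z)`, then
`apOver (apd f q) = apd f (ap k q)` for all `q : x = z`. -/
def apOverApd (i j : ℕ) (X P k h f x z q : Raw) : Raw :=
  idElim i j X x (fun z q =>
    Id j (Id j (P ⬝ (k ⬝ z))
        (transport i j X (P ⬝ ·) (k ⬝ x) (k ⬝ z) (ap i i X X (k ⬝ ·) x z q) (h ⬝ x ⬝ (f ⬝ x)))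
        (h ⬝ z ⬝ (f ⬝ z)))
      (apOver i j X P k h x (f ⬝ x) z q (f ⬝ z) (apd i j X (P ⬝ ·) (f ⬝ ·) x z q))
      (apd i j X (P ⬝ ·) (f ⬝ ·) (k ⬝ x) (k ⬝ z) (ap i i X X (k ⬝ ·) x z q)))
    (refl j (Id j (P ⬝ (k ⬝ x)) (h ⬝ x ⬝ (f ⬝ x)) (h ⬝ x ⬝ (f ⬝ x)))
      (refl j (P ⬝ (k ⬝ x)) (h ⬝ x ⬝ (f ⬝ x)))) z q

/-- The first part of the data of an induction over `F(A)` with motive `P`: one method for each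
point constructor. -/
structure PointMethods where
  A : Raw
  P : Raw
  pUnit : Raw
  pCons : Raw
  pIcons : Raw

/-- The data of an induction over `F(A)`: one method for each constructor. -/
structure Methods extends PointMethods where
  pMu1 : Raw
  pMu2 : Raw
  pMu : Raw

/-- The element `icons (cons y)` of the motive at `icons_a (cons_a x)`, for `y` in the motive
at `x`. -/
def PointMethods.ic (M : PointMethods) (i : ℕ) (a x y : Raw) : Raw :=
  M.pIcons ⬝ a ⬝ (cons i M.A a ⬝ x) ⬝ (M.pCons ⬝ a ⬝ x ⬝ y)

/-- The family of the types `transport q (cons (icons (cons y))) = cons y` of identifications in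
the motive, over `q : cons_a (icons_a (cons_a x)) = cons_a x`. -/
def PointMethods.overFam (M : PointMethods) (i j : ℕ) (a x y q : Raw) : Raw :=
  let x' := icons i M.A a ⬝ (cons i M.A a ⬝ x)
  Id j (M.P ⬝ (cons i M.A a ⬝ x))
    (transport i j (F i M.A) (M.P ⬝ ·) (cons i M.A a ⬝ x') (cons i M.A a ⬝ x) q
      (M.pCons ⬝ a ⬝ x' ⬝ M.ic i a x y))
    (M.pCons ⬝ a ⬝ x ⬝ y)

/-- The type of identifications `cons_a (icons_a (cons_a x)) = cons_a x`. -/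
def PointMethods.overBase (M : PointMethods) (i : ℕ) (a x : Raw) : Raw :=
  Id i (F i M.A) (cons i M.A a ⬝ (icons i M.A a ⬝ (cons i M.A a ⬝ x))) (cons i M.A a ⬝ x)

/-- Transport in `overFam` along `mu a x`. -/
def PointMethods.overMu (M : PointMethods) (i j : ℕ) (a x y r : Raw) : Raw :=
  transport i j (M.overBase i a x) (M.overFam i j a x y)
    (apConsMu1 i M.A a x) (mu2 i M.A a (cons i M.A a ⬝ x)) (mu i M.A a x) r

/-- `cons` applied to an identification `r : transport (mu1 a x) (icons (cons y)) = y`. -/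
def PointMethods.consOver (M : PointMethods) (i j : ℕ) (a x y r : Raw) : Raw :=
  apOver i j (F i M.A) M.P (cons i M.A a) (M.pCons ⬝ a)
    (icons i M.A a ⬝ (cons i M.A a ⬝ x)) (M.ic i a x y) x (mu1 i M.A a x) y r

/-- The type of functions from a list of methods for the induction over `F(A)` to `k`. -/
def withMethods (i j : ℕ) (k : Methods → Raw) : Raw :=
  pi (U i) fun A =>
  pi (F i A ⇒ U j) fun P =>
  pi (P ⬝ unit i A) fun pUnit =>
  pi (pi A fun a => pi (F i A) fun x => P ⬝ x ⇒ P ⬝ (cons i A a ⬝ x)) fun pCons =>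
  pi (pi A fun a => pi (F i A) fun x => P ⬝ x ⇒ P ⬝ (icons i A a ⬝ x)) fun pIcons =>
  pi (pi A fun a => pi (F i A) fun x => pi (P ⬝ x) fun y =>
    Id j (P ⬝ x)
      (transport i j (F i A) (P ⬝ ·) (icons i A a ⬝ (cons i A a ⬝ x)) x (mu1 i A a x)
        (pIcons ⬝ a ⬝ (cons i A a ⬝ x) ⬝ (pCons ⬝ a ⬝ x ⬝ y))) y) fun pMu1 =>
  pi (pi A fun a => pi (F i A) fun x => pi (P ⬝ x) fun y =>
    Id j (P ⬝ x)
      (transport i j (F i A) (P ⬝ ·) (cons i A a ⬝ (icons i A a ⬝ x)) x (mu2 i A a x)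
        (pCons ⬝ a ⬝ (icons i A a ⬝ x) ⬝ (pIcons ⬝ a ⬝ x ⬝ y))) y) fun pMu2 =>
  pi (pi A fun a => pi (F i A) fun x => pi (P ⬝ x) fun y =>
    let M : PointMethods := ⟨A, P, pUnit, pCons, pIcons⟩
    Id j (M.overFam i j a x y (mu2 i A a (cons i A a ⬝ x)))
      (M.overMu i j a x y (M.consOver i j a x y (pMu1 ⬝ a ⬝ x ⬝ y)))
      (pMu2 ⬝ a ⬝ (cons i A a ⬝ x) ⬝ (pCons ⬝ a ⬝ x ⬝ y))) fun pMu =>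
  k ⟨⟨A, P, pUnit, pCons, pIcons⟩, pMu1, pMu2, pMu⟩

/-- A constant applied to a list of methods. -/
def Methods.appTo (M : Methods) (c : Cst) : Raw :=
  cst c ⬝ M.A ⬝ M.P ⬝ M.pUnit ⬝ M.pCons ⬝ M.pIcons ⬝ M.pMu1 ⬝ M.pMu2 ⬝ M.pMu

/-- The dependent function on `F(A)` that is defined by a list of methods. -/
def Methods.elim (M : Methods) (i j : ℕ) : Raw := M.appTo (.freeElim i j)

/-- The identification `overMu (consOver (apd f mu1)) = apd f mu2` that every dependent function
`f` on `F(A)` with `f (cons_a x) ≡ cons (f x)` satisfies, for `f = M.elim`. -/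
def Methods.recOverMu (M : Methods) (i j : ℕ) (a x : Raw) : Raw :=
  let f := M.elim i j
  let c := cons i M.A a
  let x' := icons i M.A a ⬝ (c ⬝ x)
  let T := M.overFam i j a x (f ⬝ x)
  let E := M.overBase i a x
  let l := apConsMu1 i M.A a x
  let m := mu2 i M.A a (c ⬝ x)
  let r := M.consOver i j a x (f ⬝ x) (apd i j (F i M.A) (M.P ⬝ ·) (f ⬝ ·) x' x (mu1 i M.A a x))
  let r' := apd i j (F i M.A) (M.P ⬝ ·) (f ⬝ ·) (c ⬝ x') (c ⬝ x) l
  let s := apd i j (F i M.A) (M.P ⬝ ·) (f ⬝ ·) (c ⬝ x') (c ⬝ x) m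
  concat j (T m) (M.overMu i j a x (f ⬝ x) r) (M.overMu i j a x (f ⬝ x) r') s
    (ap j j (T l) (T m) (fun t => M.overMu i j a x (f ⬝ x) t) r r'
      (apOverApd i j (F i M.A) M.P c (M.pCons ⬝ a) f x' x (mu1 i M.A a x)))
    (apd i j E T (fun q => apd i j (F i M.A) (M.P ⬝ ·) (f ⬝ ·) (c ⬝ x') (c ⬝ x) q) l m
      (mu i M.A a x))

/-! ### The types of the constants -/

/-- The type of each constant, with named variables. -/
def typeOf : Cst → Raw
  | .sig i => pi (U i) fun A => (A ⇒ U i) ⇒ U i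
  | .pair i =>
      pi (U i) fun A => pi (A ⇒ U i) fun B => pi A fun a => B ⬝ a ⇒ cst (.sig i) ⬝ A ⬝ B
  | .sigElim i j =>
      pi (U i) fun A => pi (A ⇒ U i) fun B => pi (cst (.sig i) ⬝ A ⬝ B ⇒ U j) fun C =>
      (pi A fun a => pi (B ⬝ a) fun b => C ⬝ (cst (.pair i) ⬝ A ⬝ B ⬝ a ⬝ b)) ⇒
      pi (cst (.sig i) ⬝ A ⬝ B) fun p => C ⬝ p
  | .id i => pi (U i) fun A => A ⇒ A ⇒ U i
  | .refl i => pi (U i) fun A => pi A fun x => Id i A x x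
  | .idElim i j =>
      pi (U i) fun A => pi A fun a => pi (pi A fun b => Id i A a b ⇒ U j) fun C =>
      C ⬝ a ⬝ refl i A a ⇒ pi A fun b => pi (Id i A a b) fun p => C ⬝ b ⬝ p
  | .funext i =>
      pi (U i) fun A => pi (A ⇒ U i) fun B =>
      pi (pi A fun x => B ⬝ x) fun f => pi (pi A fun x => B ⬝ x) fun g =>
      IsEquiv i (Id i (pi A fun x => B ⬝ x) f g) (pi A fun x => Id i (B ⬝ x) (f ⬝ x) (g ⬝ x))
        (happly i A B f g)
  | .univalence i =>
      pi (U i) fun A => pi (U i) fun B =>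
      IsEquiv (i + 1) (Id (i + 1) (U i) A B) (Equiv i A B) (idToEquiv i A B)
  | .free i => U i ⇒ U i
  | .unit i => pi (U i) fun A => F i A
  | .cons i => pi (U i) fun A => A ⇒ F i A ⇒ F i A
  | .icons i => pi (U i) fun A => A ⇒ F i A ⇒ F i A
  | .mu1 i =>
      pi (U i) fun A => pi A fun a => pi (F i A) fun x =>
      Id i (F i A) (icons i A a ⬝ (cons i A a ⬝ x)) x
  | .mu2 i =>
      pi (U i) fun A => pi A fun a => pi (F i A) fun x =>
      Id i (F i A) (cons i A a ⬝ (icons i A a ⬝ x)) x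
  | .mu i =>
      pi (U i) fun A => pi A fun a => pi (F i A) fun x =>
      Id i (Id i (F i A) (cons i A a ⬝ (icons i A a ⬝ (cons i A a ⬝ x))) (cons i A a ⬝ x))
        (apConsMu1 i A a x) (mu2 i A a (cons i A a ⬝ x))
  | .freeElim i j => withMethods i j fun M => pi (F i M.A) fun x => M.P ⬝ x
  | .freeElimMu1 i j => withMethods i j fun M =>
      let f := M.elim i j
      pi M.A fun a => pi (F i M.A) fun x =>
      let x' := icons i M.A a ⬝ (cons i M.A a ⬝ x)
      Id j
        (Id j (M.P ⬝ x)
          (transport i j (F i M.A) (M.P ⬝ ·) x' x (mu1 i M.A a x) (f ⬝ x')) (f ⬝ x))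
        (apd i j (F i M.A) (M.P ⬝ ·) (f ⬝ ·) x' x (mu1 i M.A a x)) (M.pMu1 ⬝ a ⬝ x ⬝ (f ⬝ x))
  | .freeElimMu2 i j => withMethods i j fun M =>
      let f := M.elim i j
      pi M.A fun a => pi (F i M.A) fun x =>
      let x' := cons i M.A a ⬝ (icons i M.A a ⬝ x)
      Id j
        (Id j (M.P ⬝ x)
          (transport i j (F i M.A) (M.P ⬝ ·) x' x (mu2 i M.A a x) (f ⬝ x')) (f ⬝ x))
        (apd i j (F i M.A) (M.P ⬝ ·) (f ⬝ ·) x' x (mu2 i M.A a x)) (M.pMu2 ⬝ a ⬝ x ⬝ (f ⬝ x))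
  -- modulo the rules for `mu1` and `mu2`, the action of `f` on `mu` is given by `pMu`
  | .freeElimMu i j => withMethods i j fun M =>
      let f := M.elim i j
      pi M.A fun a => pi (F i M.A) fun x =>
      let c := cons i M.A a
      let x' := icons i M.A a ⬝ (c ⬝ x)
      let m := mu2 i M.A a (c ⬝ x)
      let T := M.overFam i j a x (f ⬝ x)
      let S := Id j (M.P ⬝ x)
        (transport i j (F i M.A) (M.P ⬝ ·) x' x (mu1 i M.A a x) (f ⬝ x')) (f ⬝ x)
      let d := apd i j (F i M.A) (M.P ⬝ ·) (f ⬝ ·) x' x (mu1 i M.A a x)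
      let d' := M.pMu1 ⬝ a ⬝ x ⬝ (f ⬝ x)
      let lhs := fun t : Raw => M.overMu i j a x (f ⬝ x) (M.consOver i j a x (f ⬝ x) t)
      let s := apd i j (F i M.A) (M.P ⬝ ·) (f ⬝ ·) (c ⬝ x') (c ⬝ x) m
      let s' := M.pMu2 ⬝ a ⬝ (c ⬝ x) ⬝ (f ⬝ (c ⬝ x))
      Id j (Id j (T m) (lhs d) s')
        (concat j (T m) (lhs d) (lhs d') s'
          (ap j j S (T m) lhs d d' (M.appTo (.freeElimMu1 i j) ⬝ a ⬝ x))
          (M.pMu ⬝ a ⬝ x ⬝ (f ⬝ x)))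
        (concat j (T m) (lhs d) s s'
          (M.recOverMu i j a x) (M.appTo (.freeElimMu2 i j) ⬝ a ⬝ (c ⬝ x)))
  | .wedge i => U i ⇒ U i
  | .north i => pi (U i) fun A => W i A
  | .loops i => pi (U i) fun A => A ⇒ loopSpace i A
  | .wedgeElim i j =>
      pi (U i) fun A => pi (W i A ⇒ U j) fun P => pi (P ⬝ north i A) fun n =>
      (pi A fun a => Id j (P ⬝ north i A)
        (transport i j (W i A) (P ⬝ ·) (north i A) (north i A) (loops i A a) n) n) ⇒
      pi (W i A) fun w => P ⬝ w
  | .wedgeElimLoops i j =>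
      pi (U i) fun A => pi (W i A ⇒ U j) fun P => pi (P ⬝ north i A) fun n =>
      pi (pi A fun a => Id j (P ⬝ north i A)
        (transport i j (W i A) (P ⬝ ·) (north i A) (north i A) (loops i A a) n) n) fun l =>
      pi A fun a =>
      Id j (Id j (P ⬝ north i A)
          (transport i j (W i A) (P ⬝ ·) (north i A) (north i A) (loops i A a) n) n)
        (apd i j (W i A) (P ⬝ ·) (cst (.wedgeElim i j) ⬝ A ⬝ P ⬝ n ⬝ l ⬝ ·) (north i A) (north i A)
          (loops i A a)) (l ⬝ a)
  | .trunc i => U i ⇒ U i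
  | .truncIn i => pi (U i) fun A => A ⇒ Trunc i A
  | .truncSet i => pi (U i) fun A => IsSet i (Trunc i A)
  | .truncElim i j =>
      pi (U i) fun A => pi (Trunc i A ⇒ U j) fun P =>
      (pi (Trunc i A) fun t => IsSet j (P ⬝ t)) ⇒
      (pi A fun a => P ⬝ (cst (.truncIn i) ⬝ A ⬝ a)) ⇒
      pi (Trunc i A) fun t => P ⬝ t

/-- The type of each constant, as a closed term. -/
def Cst.type (c : Cst) : Tm := close (typeOf c)

/-! ### Definitional equality and typing -/

/-- A term applied to a list of arguments. -/
def Tm.apps (f : Tm) (l : List Tm) : Tm := l.foldl .app f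

/-- Definitional equality: the congruence generated by the `β` and `η` rules for functions and by
the defining equations of the eliminators at point constructors. -/
inductive Conv : Tm → Tm → Prop
  | refl (t : Tm) : Conv t t
  | symm {s t : Tm} : Conv s t → Conv t s
  | trans {s t u : Tm} : Conv s t → Conv t u → Conv s u
  | pi {A A' B B' : Tm} : Conv A A' → Conv B B' → Conv (.pi A B) (.pi A' B')
  | lam {b b' : Tm} : Conv b b' → Conv (.lam b) (.lam b')
  | app {f f' a a' : Tm} : Conv f f' → Conv a a' → Conv (.app f a) (.app f' a')
  | beta (b a : Tm) : Conv (.app (.lam b) a) (b.subst a 0)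
  | eta (f : Tm) : Conv (.lam (.app (f.lift 1 0) (.var 0))) f
  | sigElim (i j i' : ℕ) (A B C g A' B' a b : Tm) :
      Conv ((Tm.cst (.sigElim i j)).apps [A, B, C, g, (Tm.cst (.pair i')).apps [A', B', a, b]])
        (g.apps [a, b])
  | idElim (i j i' : ℕ) (A a C c b A' a' : Tm) :
      Conv ((Tm.cst (.idElim i j)).apps [A, a, C, c, b, (Tm.cst (.refl i')).apps [A', a']]) c
  | freeElim_unit (i j i' : ℕ) (A P u c d p q r A' : Tm) :
      Conv ((Tm.cst (.freeElim i j)).apps [A, P, u, c, d, p, q, r,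
        (Tm.cst (.unit i')).apps [A']]) u
  | freeElim_cons (i j i' : ℕ) (A P u c d p q r A' a x : Tm) :
      Conv ((Tm.cst (.freeElim i j)).apps [A, P, u, c, d, p, q, r,
          (Tm.cst (.cons i')).apps [A', a, x]])
        (c.apps [a, x, (Tm.cst (.freeElim i j)).apps [A, P, u, c, d, p, q, r, x]])
  | freeElim_icons (i j i' : ℕ) (A P u c d p q r A' a x : Tm) :
      Conv ((Tm.cst (.freeElim i j)).apps [A, P, u, c, d, p, q, r,
          (Tm.cst (.icons i')).apps [A', a, x]])
        (d.apps [a, x, (Tm.cst (.freeElim i j)).apps [A, P, u, c, d, p, q, r, x]])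
  | wedgeElim (i j i' : ℕ) (A P n l A' : Tm) :
      Conv ((Tm.cst (.wedgeElim i j)).apps [A, P, n, l, (Tm.cst (.north i')).apps [A']]) n
  | truncElim (i j i' : ℕ) (A P s g A' a : Tm) :
      Conv ((Tm.cst (.truncElim i j)).apps [A, P, s, g, (Tm.cst (.truncIn i')).apps [A', a]])
        (g.apps [a])

/-- `HasType Γ t A`: the term `t` has type `A` in the context `Γ`. The context lists the types of
the variables, the most recent variable first. In a derivation that starts with the empty
context, a context is only ever extended by a type in one of the universes. -/
inductive HasType : List Tm → Tm → Tm → Prop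
  | var {Γ : List Tm} {n : ℕ} {A : Tm} : Γ[n]? = some A → HasType Γ (.var n) (A.lift (n + 1) 0)
  | univ (Γ : List Tm) (i : ℕ) : HasType Γ (.univ i) (.univ (i + 1))
  | cumul {Γ : List Tm} {A : Tm} {i : ℕ} :
      HasType Γ A (.univ i) → HasType Γ A (.univ (i + 1))
  | pi {Γ : List Tm} {A B : Tm} {i : ℕ} :
      HasType Γ A (.univ i) → HasType (A :: Γ) B (.univ i) → HasType Γ (.pi A B) (.univ i)
  | lam {Γ : List Tm} {A B b : Tm} {i : ℕ} :
      HasType Γ A (.univ i) → HasType (A :: Γ) b B → HasType Γ (.lam b) (.pi A B)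
  | app {Γ : List Tm} {A B f a : Tm} :
      HasType Γ f (.pi A B) → HasType Γ a A → HasType Γ (.app f a) (B.subst a 0)
  | cst (Γ : List Tm) (c : Cst) : HasType Γ (.cst c) c.type
  | conv {Γ : List Tm} {t A B : Tm} {i : ℕ} :
      HasType Γ t A → HasType Γ B (.univ i) → Conv A B → HasType Γ t B

/-- A type of type theory, given as a closed term, is inhabited: some closed term has this
type. -/
def IsInhabited (T : Raw) : Prop := ∃ t : Tm, HasType [] t (close T)

/-- `(X, x)` is a delooping of `G`, so that `G` is a higher group represented by `(X, x)`: the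
type `X` is connected and `G` is equivalent to `x = x`. -/
def Delooping (i : ℕ) (G X x : Raw) : Raw :=
  Times i (IsConnected i X) (Equiv i G (Id i X x x))

/-- The map `G → (x = x)` underlying a delooping `(X, x)` of `G`. -/
def Delooping.map (i : ℕ) (G X x d : Raw) : Raw :=
  Equiv.map i G (Id i X x x) (snd i (IsConnected i X) (Equiv i G (Id i X x x)) d)

end HoTT

/-! The mathematical argument is an encode-decode proof. By univalence each equivalence `cons_a`
yields an identification of F(A) with itself, so W(A)-recursion defines a family C, the universal
cover, with C(N) = F(A), in which transport along `loops a` is inverse to `cons_a`. An element of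
C(w) is to be thought of as a path from w to N. The total space of C contracts to (N, unit)
(`contrDef`). Over N this needs an identification (N, x) = (N, unit) for each x in F(A). It is found
by induction on F(A), where `cons_a` acts by concatenation with the lift of `loops a` that runs from
(N, cons_a x) to (N, x). The map e projects the resulting path to W(A), and its inverse sends p to
the transport of unit along p⁻¹. Since the induction computes at unit and at `cons_a x`, the
equation e(unit) = refl holds by computation, and the one for e(cons_a x) follows because projection
respects concatenation.

The delicate point is the induction over F(A), which asks for methods for `icons`, `mu1`, `mu2` and
`mu`. They are supplied all at once by `freeIndDef`: it suffices that the method for `cons_a`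
consists of equivalences between the fibers. This rests on `invOverDef`, a statement about a map of
families over an arbitrary equivalence. Univalence reduces it to the identity equivalence, where the
required data are the components of a half-adjoint equivalence in each fiber. Concatenation with a
path is an equivalence, so the principle applies. The computation rules of F(A) for paths are never
used.

The theorem asks for a closed term of a formal system and hence for a large typing derivation. It is
produced by reflection: a type checker `run` is a Lean function with bounded recursion depth, and
`run_sound` turns its positive answers into derivations. Only soundness is needed, so no confluence,
normalization or subject reduction enters. The argument is written as a list of definitions that
refer to earlier ones by variables. Each definition is checked by kernel evaluation, and the
references are then replaced by closed values (`exists_sound`). The types of the constants are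
validated beforehand in the order of their dependence (`type_isType`).

All of this is done for the lowest universe, with motives in the next one where univalence and the
cover need it. The rules are uniform in the levels, so `HasType.shift` carries the derivation to
every universe. -/

namespace HoTT

/-! ### An executable type checker: syntactic equality. -/

/-- A numerical code of a constant: its kind and the levels that occur in its type. The type of
a constant contains only constants of smaller kinds. -/
def Cst.code : Cst → ℕ × ℕ × ℕ
  | .sig i => (0, i, 0) | .pair i => (1, i, 0) | .sigElim i j => (2, i, j)
  | .id i => (3, i, 0) | .refl i => (4, i, 0) | .idElim i j => (5, i, j)
  | .funext i => (6, i, 0) | .univalence i => (7, i, i + 1)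
  | .free i => (8, i, 0) | .unit i => (9, i, 0) | .cons i => (10, i, 0) | .icons i => (11, i, 0)
  | .mu1 i => (12, i, 0) | .mu2 i => (13, i, 0) | .mu i => (14, i, 0)
  | .freeElim i j => (15, i, j)
  | .wedge i => (16, i, 0) | .north i => (17, i, 0) | .loops i => (18, i, 0)
  | .wedgeElim i j => (19, i, j)
  | .trunc i => (20, i, 0) | .truncIn i => (21, i, 0) | .truncSet i => (22, i, 0)
  | .truncElim i j => (23, i, j) | .wedgeElimLoops i j => (24, i, j)
  | .freeElimMu1 i j => (25, i, j) | .freeElimMu2 i j => (26, i, j) | .freeElimMu i j => (27, i, j)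

/-- Equality of constants. -/
def Cst.beq (c d : Cst) : Bool :=
  c.code.1.beq d.code.1 && (c.code.2.1.beq d.code.2.1 && c.code.2.2.beq d.code.2.2)

/-- Syntactic equality of terms. -/
def Tm.beq : Tm → Tm → Bool
  | .var n, .var m => n.beq m
  | .univ n, .univ m => n.beq m
  | .pi A B, .pi A' B' => A.beq A' && B.beq B'
  | .lam b, .lam b' => b.beq b'
  | .app f a, .app f' a' => f.beq f' && a.beq a'
  | .cst c, .cst c' => c.beq c'
  | _, _ => false

/-! ### Definitions and weak head reduction. -/

/-- A definition: a value and its type. -/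
structure Entry where
  val : Tm
  type : Tm

/-- The `k`-th definition of a list. -/
def lookup : List Entry → ℕ → Option Entry
  | [], _ => none
  | e :: G, k => match k with
    | 0 => some e
    | k + 1 => lookup G k

/-- Reduction of `t` applied to `st`, where `t` is an eliminator of dependent sums. The function
`r₀` reduces the principal argument, and `r` reduces the result. -/
def redSig (r₀ r : Tm → List Tm → Tm × List Tm) (t : Tm) (st : List Tm) : Tm × List Tm :=
  match st with
  | _ :: _ :: _ :: g :: p :: rest => match r₀ p [] with
    | (.cst (.pair _), [_, _, a, b]) => r g (a :: b :: rest)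
    | _ => (t, st)
  | _ => (t, st)

/-- Reduction of `t` applied to `st`, where `t` is an eliminator of identity types. -/
def redId (r₀ r : Tm → List Tm → Tm × List Tm) (t : Tm) (st : List Tm) : Tm × List Tm :=
  match st with
  | _ :: _ :: _ :: g :: _ :: p :: rest => match r₀ p [] with
    | (.cst (.refl _), [_, _]) => r g rest
    | _ => (t, st)
  | _ => (t, st)

/-- Reduction of `t` applied to `st`, where `t` is an eliminator of free higher groups. -/
def redFree (r₀ r : Tm → List Tm → Tm × List Tm) (t : Tm) (st : List Tm) : Tm × List Tm :=
  match st with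
  | A :: P :: u :: g :: h :: p :: q :: s :: x :: rest => match r₀ x [] with
    | (.cst (.unit _), [_]) => r u rest
    | (.cst (.cons _), [_, a, y]) => r g (a :: y :: t.apps [A, P, u, g, h, p, q, s, y] :: rest)
    | (.cst (.icons _), [_, a, y]) => r h (a :: y :: t.apps [A, P, u, g, h, p, q, s, y] :: rest)
    | _ => (t, st)
  | _ => (t, st)

/-- Reduction of `t` applied to `st`, where `t` is an eliminator of wedges of circles. -/
def redWedge (r₀ r : Tm → List Tm → Tm × List Tm) (t : Tm) (st : List Tm) : Tm × List Tm :=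
  match st with
  | _ :: _ :: g :: _ :: w :: rest => match r₀ w [] with
    | (.cst (.north _), [_]) => r g rest
    | _ => (t, st)
  | _ => (t, st)

/-- Reduction of the constant `c` applied to `st`. -/
def redCst (r₀ r : Tm → List Tm → Tm × List Tm) (c : Cst) (st : List Tm) : Tm × List Tm :=
  match c with
  | .sigElim _ _ => redSig r₀ r (.cst c) st
  | .idElim _ _ => redId r₀ r (.cst c) st
  | .freeElim _ _ => redFree r₀ r (.cst c) st
  | .wedgeElim _ _ => redWedge r₀ r (.cst c) st
  | c => (.cst c, st)

/-- Reduction of `lam b` applied to `st`. -/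
def redLam (r : Tm → List Tm → Tm × List Tm) (b : Tm) (st : List Tm) : Tm × List Tm :=
  match st with
  | a :: st => r (b.subst a 0) st
  | [] => (.lam b, [])

/-- Reduction of the variable `k`, with definition `e`, applied to `st`. -/
def redVar (r : Tm → List Tm → Tm × List Tm) (d k : ℕ) (e : Option Entry) (st : List Tm) :
    Tm × List Tm :=
  match e with
  | some e => r (e.val.lift d 0) st
  | none => (.var k, st)

/-- The definition that the variable `k` refers to when there are `d` local variables. -/
def lookupVar (G : List Entry) (d k : ℕ) : Option Entry :=
  bif d.ble k then lookup G (k - d) else none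

/-- Weak head reduction of `t` applied to the arguments `st`, with `d` local variables in scope;
the other variables refer to the definitions `G`. If `δ` is false, then the head is not replaced
by its definition. -/
def red (G : List Entry) (d : ℕ) : ℕ → Bool → Tm → List Tm → Tm × List Tm
  | 0, _, t, st => (t, st)
  | n + 1, δ, t, st => match t with
    | .app f a => red G d n δ f (a :: st)
    | .lam b => redLam (red G d n δ) b st
    | .var k => redVar (red G d n δ) d k (bif δ then lookupVar G d k else none) st
    -- The principal argument is always reduced with unfolding, because its constructor may be
    -- hidden behind a definition.
    | .cst c => redCst (red G d n true) (red G d n δ) c st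
    | t => (t, st)

/-- Weak head normal form. -/
def whnf (G : List Entry) (n d : ℕ) (t : Tm) : Tm :=
  let r := red G d n true t []
  r.1.apps r.2

/-! ### The conversion test. -/

/-- Pairwise comparison of two lists of terms. -/
def all2 (r : Tm → Tm → Bool) : List Tm → List Tm → Bool
  | [], [] => true
  | a :: l, a' :: l' => r a a' && all2 r l l'
  | _, _ => false

/-- Comparison of heads with the relation `r` on subterms, which is given the number of binders
that are entered. -/
def headEq (r : ℕ → Tm → Tm → Bool) : Tm → Tm → Bool
  | .var n, .var m => n.beq m
  | .univ n, .univ m => n.beq m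
  | .cst c, .cst c' => c.beq c'
  | .pi A B, .pi A' B' => r 0 A A' && r 1 B B'
  | .lam b, .lam b' => r 1 b b'
  | _, _ => false

/-- Comparison of terms that are given by a head and arguments. -/
def spineEq (r : ℕ → Tm → Tm → Bool) (s t : Tm × List Tm) : Bool :=
  headEq r s.1 t.1 && all2 (r 0) s.2 t.2

/-- The body of the `η`-expansion. -/
def Tm.etaBody (t : Tm) : Tm := .app (t.lift 1 0) (.var 0)

/-- Comparison of a function with a term by `η`-expansion. -/
def etaEq (r : ℕ → Tm → Tm → Bool) : Tm × List Tm → Tm × List Tm → Bool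
  | (.lam b, []), (f, st) => r 1 b (f.apps st).etaBody
  | (f, st), (.lam b, []) => r 1 (f.apps st).etaBody b
  | _, _ => false

/-- The index of the definition that a term is an abbreviation for, plus one, and zero if it is
no definition. -/
def height (G : List Entry) (d : ℕ) : Tm → ℕ
  | .var k => (lookupVar G d k).elim 0 fun _ => k - d + 1
  | _ => 0

/-- A term given by a head and arguments, with the head replaced by its definition. -/
def unfold (G : List Entry) (d : ℕ) : Tm × List Tm → Tm
  | (.var k, st) => match lookupVar G d k with
    | some e => (e.val.lift d 0).apps st
    | none => (Tm.var k).apps st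
  | (f, st) => f.apps st

/-- One step of the comparison of terms that have been reduced: the definition with the larger
index is unfolded. -/
def stepEq (G : List Entry) (d : ℕ) (r : ℕ → Tm → Tm → Bool) (s t : Tm × List Tm) (h k : ℕ) :
    Bool :=
  bif h.beq k then
    bif h.beq 0 then etaEq r s t else r 0 (unfold G d s) (unfold G d t)
  else bif h.ble k then r 0 (s.1.apps s.2) (unfold G d t)
  else r 0 (unfold G d s) (t.1.apps t.2)

/-- Comparison of reduced terms. -/
def whnfEq (G : List Entry) (d : ℕ) (r : ℕ → Tm → Tm → Bool) (s t : Tm × List Tm) : Bool :=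
  spineEq r s t || stepEq G d r s t (height G d s.1) (height G d t.1)

/-- A test for definitional equality. -/
def conv (G : List Entry) : ℕ → ℕ → Tm → Tm → Bool
  | 0, _, _, _ => false
  | n + 1, d, s, t =>
    -- Heads that are definitions stay folded at first, so that two applications of the same
    -- definition are compared by their arguments before anything is unfolded.
    s.beq t ||
      whnfEq G d (fun k => conv G n (d + k)) (red G d n false s []) (red G d n false t [])

/-- Contraction of all `β`-redexes, for a bounded number of steps. -/
def Tm.betaNf : ℕ → Tm → List Tm → Tm
  | 0, t, st => t.apps st
  | n + 1, t, st => match t with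
    | .app f a => betaNf n f (a :: st)
    | .lam b => match st with
      | a :: st => betaNf n (b.subst a 0) st
      | [] => .lam (betaNf n b [])
    | .pi A B => Tm.apps (.pi (betaNf n A []) (betaNf n B [])) st
    | t => t.apps (st.map fun a => betaNf n a [])

/-! ### Inference and checking of types. -/

/-- The domain and codomain of a term that is a dependent product. -/
def Tm.asPi : Tm → Option (Tm × Tm)
  | .pi A B => some (A, B)
  | _ => none

/-- The level of a term that is a universe. -/
def Tm.asUniv : Tm → Option ℕ
  | .univ i => some i
  | _ => none

/-- A function that infers the type of a term in a context, or checks it against a given type. -/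
abbrev Checker : Type := List Tm → Tm → Option Tm → Option Tm

/-- The level of the type `A`. -/
def levelOf (G : List Entry) (n : ℕ) (r : Checker) (Γ : List Tm) (A : Tm) : Option ℕ :=
  (r Γ A none).bind fun S => (whnf G n Γ.length S).asUniv

/-- If `A` and `B` form a dependent product, then this product. -/
def recheckPi (G : List Entry) (n : ℕ) (r : Checker) (Γ : List Tm) (A B : Tm) :
    Option (Tm × Tm) :=
  (levelOf G n r Γ A).bind fun _ => (levelOf G n r (A :: Γ) B).map fun _ => (A, B)

/-- The dependent product that the type `T` is equal to. -/
def toPi (G : List Entry) (n : ℕ) (r : Checker) (Γ : List Tm) (T : Tm) : Option (Tm × Tm) :=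
  match T.asPi with
  | some p => some p
  -- Reduction is only shown to give a convertible term, not a well-typed one; hence the components
  -- of the reduced product are type-checked again.
  | none => (whnf G n Γ.length T).asPi.bind fun p =>
    recheckPi G n r Γ (p.1.betaNf n []) (p.2.betaNf n [])

/-- Is the type `S` equal to the type `T`, or are they universes of increasing levels? -/
def subtype (G : List Entry) (n d : ℕ) (S T : Tm) : Bool :=
  conv G n d S T ||
    (((whnf G n d S).asUniv.bind fun i => (whnf G n d T).asUniv.map fun j => i.ble j).getD false)

/-- Checking of `t` against `T` by inference. -/
def checkInfer (G : List Entry) (n : ℕ) (r : Checker) (Γ : List Tm) (t T : Tm) : Option Tm :=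
  (r Γ t none).bind fun S => bif subtype G n Γ.length S T then some T else none

/-- Checking of `lam b` against `T`. -/
def checkLam (G : List Entry) (n : ℕ) (r : Checker) (Γ : List Tm) (b T : Tm) : Option Tm :=
  (toPi G n r Γ T).bind fun p => (r (p.1 :: Γ) b (some p.2)).map fun _ => T

/-- Checking of a term. -/
def checkTm (G : List Entry) (n : ℕ) (r : Checker) (Γ : List Tm) (t T : Tm) : Option Tm :=
  match t with
  | .lam b => checkLam G n r Γ b T
  | t => checkInfer G n r Γ t T

/-- Inference for the variable `k`. -/
def inferVar (G : List Entry) (Γ : List Tm) (k : ℕ) : Option Tm :=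
  match Γ[k]? with
  | some A => some (A.lift (k + 1) 0)
  | none => (lookupVar G Γ.length k).map fun e => e.type.lift Γ.length 0

/-- Inference for `pi A B`. -/
def inferPi (G : List Entry) (n : ℕ) (r : Checker) (Γ : List Tm) (A B : Tm) : Option Tm :=
  (levelOf G n r Γ A).bind fun i => (levelOf G n r (A :: Γ) B).map fun j => .univ (max i j)

/-- Inference for `app (lam b) a`. -/
def inferRedex (r : Checker) (Γ : List Tm) (b a : Tm) : Option Tm :=
  (r Γ a none).bind fun A => (r (A :: Γ) b none).map fun B => B.subst a 0

/-- Inference for `app f a`, by inference for `f`. -/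
def inferNeutral (G : List Entry) (n : ℕ) (r : Checker) (Γ : List Tm) (f a : Tm) : Option Tm :=
  (r Γ f none).bind fun T => (toPi G n r Γ T).bind fun p =>
    (r Γ a (some p.1)).map fun _ => p.2.subst a 0

/-- Inference for `app f a`. -/
def inferApp (G : List Entry) (n : ℕ) (r : Checker) (Γ : List Tm) (f a : Tm) : Option Tm :=
  match f with
  | .lam b => inferRedex r Γ b a
  | f => inferNeutral G n r Γ f a

/-- Inference of a type. -/
def inferTm (G : List Entry) (ok : Cst → Bool) (n : ℕ) (r : Checker) (Γ : List Tm) (t : Tm) :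
    Option Tm :=
  match t with
  | .var k => inferVar G Γ k
  | .univ i => some (.univ (i + 1))
  | .pi A B => inferPi G n r Γ A B
  | .lam _ => none
  | .app f a => inferApp G n r Γ f a
  | .cst c => bif ok c then some c.type else none

/-- The type checker. `run G ok n Γ t none` infers a type of `t`, and `run G ok n Γ t (some T)`
checks `t` against `T`. Only constants that satisfy `ok` are accepted. -/
def run (G : List Entry) (ok : Cst → Bool) : ℕ → Checker
  | 0, _, _, _ => none
  | n + 1, Γ, t, some T => checkTm G n (run G ok n) Γ t T
  | n + 1, Γ, t, none => inferTm G ok n (run G ok n) Γ t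

/-! ### Lifting and substitution -/

theorem Tm.lift_zero (t : Tm) (k : ℕ) : t.lift 0 k = t := by
  induction t generalizing k <;> simp_all [Tm.lift]

theorem Tm.lift_lift (t : Tm) {a b k l : ℕ} (h₁ : k ≤ l) (h₂ : l ≤ k + a) :
    (t.lift a k).lift b l = t.lift (a + b) k := by
  induction t generalizing k l with
  | var n => simp only [Tm.lift]; split_ifs <;> simp only [Tm.lift] <;> split_ifs <;> first | omega | rfl | (congr 1; omega)
  | pi A B hA hB => simp [Tm.lift, hA h₁ h₂, hB (k := k + 1) (l := l + 1) (by omega) (by omega)]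
  | lam b hb => simp [Tm.lift, hb (k := k + 1) (l := l + 1) (by omega) (by omega)]
  | app f a hf ha => simp [Tm.lift, hf h₁ h₂, ha h₁ h₂]
  | _ => rfl

theorem Tm.lift_comm (t : Tm) {a b k l : ℕ} (h : k ≤ l) :
    (t.lift a k).lift b (l + a) = (t.lift b l).lift a k := by
  induction t generalizing k l with
  | var n => simp only [Tm.lift]; split_ifs <;> simp only [Tm.lift] <;> split_ifs <;> first | omega | rfl | (congr 1; omega)
  | pi A B hA hB =>
    have := hB (k := k + 1) (l := l + 1) (by omega)
    simp only [Tm.lift, hA h, show l + a + 1 = l + 1 + a by omega, this]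
  | lam b hb =>
    have := hb (k := k + 1) (l := l + 1) (by omega)
    simp only [Tm.lift, show l + a + 1 = l + 1 + a by omega, this]
  | app f a hf ha => simp [Tm.lift, hf h, ha h]
  | _ => rfl

theorem Tm.lift_subst (t s : Tm) (d k m : ℕ) :
    (t.subst s k).lift d (m + k) = (t.lift d (m + k + 1)).subst (s.lift d m) k := by
  induction t generalizing k with
  | var n =>
    simp only [Tm.lift, Tm.subst]
    split_ifs <;> simp only [Tm.lift, Tm.subst] <;> split_ifs <;> first
      | omega
      | rfl
      | (congr 1; omega)
      | exact Tm.lift_comm s (Nat.zero_le _)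
  | pi A B hA hB =>
    have := hB (k + 1)
    simp only [Tm.lift, Tm.subst, hA, ← Nat.add_assoc] at this ⊢; rw [this]
  | lam b hb => have := hb (k + 1); simp only [Tm.lift, Tm.subst, ← Nat.add_assoc] at this ⊢; rw [this]
  | app f a hf ha => simp [Tm.lift, Tm.subst, hf, ha]
  | _ => rfl

/-- The lift leaves the indices from `l` to `l + d` vacant, so there is no occurrence of `k` to
replace, and only the lowering of the larger variables remains. -/
theorem Tm.subst_lift (t s : Tm) {d k l : ℕ} (h₁ : l ≤ k) (h₂ : k ≤ l + d) :
    (t.lift (d + 1) l).subst s k = t.lift d l := by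
  induction t generalizing k l with
  | var n => simp only [Tm.lift]; split_ifs <;> simp only [Tm.subst] <;> split_ifs <;> first | omega | rfl
  | pi A B hA hB =>
    simp [Tm.lift, Tm.subst, hA h₁ h₂, hB (k := k + 1) (l := l + 1) (by omega) (by omega)]
  | lam b hb => simp [Tm.lift, Tm.subst, hb (k := k + 1) (l := l + 1) (by omega) (by omega)]
  | app f a hf ha => simp [Tm.lift, Tm.subst, hf h₁ h₂, ha h₁ h₂]
  | _ => rfl

theorem Tm.subst_lift_comm (t s : Tm) {d k l : ℕ} (h : l ≤ k) :
    (t.lift d l).subst s (k + d) = (t.subst s k).lift d l := by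
  induction t generalizing k l with
  | var n =>
    simp only [Tm.lift, Tm.subst]
    split_ifs <;> simp only [Tm.lift, Tm.subst] <;> split_ifs <;> first
      | omega
      | rfl
      | (congr 1; omega)
      | (rw [Tm.lift_lift _ (Nat.zero_le _) (by omega)])
  | pi A B hA hB =>
    have := hB (k := k + 1) (l := l + 1) (by omega)
    simp only [Tm.lift, Tm.subst, hA h, show k + d + 1 = k + 1 + d by omega, this]
  | lam b hb =>
    have := hb (k := k + 1) (l := l + 1) (by omega)
    simp only [Tm.lift, Tm.subst, show k + d + 1 = k + 1 + d by omega, this]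
  | app f a hf ha => simp [Tm.lift, Tm.subst, hf h, ha h]
  | _ => rfl

/-- The substitution lemma. The outer index has the form `m + j` so that the induction can raise `j`
under binders while `m` stays fixed. -/
theorem Tm.subst_subst (t s r : Tm) (j m : ℕ) :
    (t.subst s j).subst r (m + j) = (t.subst r (m + j + 1)).subst (s.subst r m) j := by
  induction t generalizing j with
  | var n =>
    simp only [Tm.subst]
    split_ifs <;> (try simp only [Tm.subst]) <;> (try split_ifs) <;> first
      | omega
      | rfl
      | exact Tm.subst_lift_comm s r (Nat.zero_le _)
      | (rw [Tm.subst_lift _ _ (Nat.zero_le _) (by omega)])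
  | pi A B hA hB =>
    have := hB (j + 1)
    simp only [Tm.subst, hA, ← Nat.add_assoc] at this ⊢; rw [this]
  | lam b hb => have := hb (j + 1); simp only [Tm.subst, ← Nat.add_assoc] at this ⊢; rw [this]
  | app f a hf ha => simp [Tm.subst, hf, ha]
  | _ => rfl

theorem Tm.lift_apps (f : Tm) (l : List Tm) (d k : ℕ) :
    (f.apps l).lift d k = (f.lift d k).apps (l.map fun t => t.lift d k) := by
  induction l generalizing f with
  | nil => rfl
  | cons a l h => exact h _

theorem Tm.subst_apps (f : Tm) (l : List Tm) (s : Tm) (k : ℕ) :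
    (f.apps l).subst s k = (f.subst s k).apps (l.map fun t => t.subst s k) := by
  induction l generalizing f with
  | nil => rfl
  | cons a l h => exact h _

theorem Conv.apps {f f' : Tm} (h : Conv f f') (l : List Tm) : Conv (f.apps l) (f'.apps l) := by
  induction l generalizing f f' with
  | nil => exact h
  | cons a l ih => exact ih (h.app (.refl a))

theorem Conv.lift {s t : Tm} (h : Conv s t) (d k : ℕ) : Conv (s.lift d k) (t.lift d k) := by
  induction h generalizing k with
  | refl t => exact .refl _
  | symm _ h => exact (h k).symm
  | trans _ _ h h' => exact (h k).trans (h' k)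
  | pi _ _ h h' => exact .pi (h k) (h' (k + 1))
  | lam _ h => exact .lam (h (k + 1))
  | app _ _ h h' => exact .app (h k) (h' k)
  | beta b a =>
    have := Tm.lift_subst b a d 0 k
    rw [Nat.add_zero] at this
    rw [this]
    exact .beta _ _
  | eta f =>
    have := Tm.lift_comm f (a := 1) (b := d) (Nat.zero_le k)
    simp only [Tm.lift, this, Nat.zero_lt_succ, if_true]
    exact .eta _
  | _ =>
    simp only [Tm.lift_apps, List.map, Tm.lift]
    first
      | apply Conv.sigElim
      | apply Conv.idElim
      | apply Conv.freeElim_unit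
      | apply Conv.freeElim_cons
      | apply Conv.freeElim_icons
      | apply Conv.wedgeElim
      | apply Conv.truncElim

theorem Conv.subst {s t : Tm} (h : Conv s t) (r : Tm) (k : ℕ) :
    Conv (s.subst r k) (t.subst r k) := by
  induction h generalizing k with
  | refl t => exact .refl _
  | symm _ h => exact (h k).symm
  | trans _ _ h h' => exact (h k).trans (h' k)
  | pi _ _ h h' => exact .pi (h k) (h' (k + 1))
  | lam _ h => exact .lam (h (k + 1))
  | app _ _ h h' => exact .app (h k) (h' k)
  | beta b a =>
    have := Tm.subst_subst b a r 0 k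
    rw [Nat.add_zero] at this
    rw [this]
    exact .beta _ _
  | eta f =>
    have := Tm.subst_lift_comm f r (d := 1) (Nat.zero_le k)
    simp only [Tm.subst, this, Nat.zero_lt_succ, if_true]
    exact .eta _
  | _ =>
    simp only [Tm.subst_apps, List.map, Tm.subst]
    first
      | apply Conv.sigElim
      | apply Conv.idElim
      | apply Conv.freeElim_unit
      | apply Conv.freeElim_cons
      | apply Conv.freeElim_icons
      | apply Conv.wedgeElim
      | apply Conv.truncElim

/-! ### Weakening and substitution for typing -/

/-- Each of these types is a concrete closed term up to its levels, so lifting it evaluates to the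
same term. -/
theorem Cst.lift_type (c : Cst) (d k : ℕ) : c.type.lift d k = c.type := by
  cases c <;> rfl

/-- A term that is equal to its own lift does not contain the variable that is substituted. -/
theorem Cst.subst_type (c : Cst) (s : Tm) (k : ℕ) : c.type.subst s k = c.type := by
  conv_lhs => rw [← c.lift_type 1 k, Tm.subst_lift _ _ le_rfl (by omega), Tm.lift_zero]

/-- `Insert d k Γ Δ`: the context `Δ` arises from `Γ` by the insertion of `d` variables before
the last `k` ones. -/
inductive Insert (d : ℕ) : ℕ → List Tm → List Tm → Prop
  | zero {Γ Ξ : List Tm} : Ξ.length = d → Insert d 0 Γ (Ξ ++ Γ)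
  | succ {k : ℕ} {Γ Δ : List Tm} (A : Tm) :
      Insert d k Γ Δ → Insert d (k + 1) (A :: Γ) (A.lift d k :: Δ)

theorem Insert.get {d k : ℕ} {Γ Δ : List Tm} (h : Insert d k Γ Δ) {n : ℕ} {A : Tm}
    (hn : Γ[n]? = some A) :
    if n < k then Δ[n]? = some (A.lift d (k - (n + 1))) else Δ[n + d]? = some A := by
  induction h generalizing n with
  | zero h => simp [← h, List.getElem?_append_right, hn]
  | succ B _ ih =>
    cases n with
    | zero => simp_all
    | succ n =>
      have := ih (n := n) (by simpa using hn)
      simp only [Nat.add_lt_add_iff_right, List.getElem?_cons_succ, Nat.add_sub_add_right,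
        Nat.add_right_comm n 1 d]
      exact this

theorem HasType.lift {d k : ℕ} {Γ Δ : List Tm} {t A : Tm} (h : HasType Γ t A)
    (i : Insert d k Γ Δ) : HasType Δ (t.lift d k) (A.lift d k) := by
  induction h generalizing k Δ with
  | @var Γ n A hn =>
    have := i.get hn
    simp only [Tm.lift]
    split_ifs at this ⊢ with hk
    · have e := Tm.lift_comm A (a := n + 1) (b := d) (Nat.zero_le (k - (n + 1)))
      rw [Nat.sub_add_cancel hk] at e
      exact e ▸ .var this
    · rw [Tm.lift_lift _ (Nat.zero_le _) (by omega), Nat.add_right_comm]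
      exact .var this
  | univ Γ i => exact .univ _ _
  | cumul _ ih => exact .cumul (ih i)
  | pi _ _ ih ih' => exact .pi (ih i) (ih' (i.succ _))
  | lam _ _ ih ih' => exact .lam (ih i) (ih' (i.succ _))
  | @app Γ A B f a _ _ ih ih' =>
    have := Tm.lift_subst B a d 0 k
    rw [Nat.add_zero] at this
    rw [this]
    exact .app (ih i) (ih' i)
  | cst Γ c => exact (c.lift_type d k).symm ▸ .cst _ c
  | conv _ _ c ih ih' => exact .conv (ih i) (ih' i) (c.lift d k)

theorem HasType.weaken {Γ : List Tm} {t A : Tm} (h : HasType Γ t A) (Ξ : List Tm) :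
    HasType (Ξ ++ Γ) (t.lift Ξ.length 0) (A.lift Ξ.length 0) := h.lift (.zero rfl)

/-- `Replace a A k Γ Δ`: the context `Δ` arises from `Γ` by the substitution of the term `a` of
type `A` for the variable `k`. -/
inductive Replace (a A : Tm) : ℕ → List Tm → List Tm → Prop
  | zero {Γ : List Tm} : HasType Γ a A → Replace a A 0 (A :: Γ) Γ
  | succ {k : ℕ} {Γ Δ : List Tm} (B : Tm) :
      Replace a A k Γ Δ → Replace a A (k + 1) (B :: Γ) (B.subst a k :: Δ)

/-- The three positions of a variable relative to the replaced one, matching the case distinction in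
`Tm.subst`. -/
theorem Replace.get {a A : Tm} {k : ℕ} {Γ Δ : List Tm} (h : Replace a A k Γ Δ) {n : ℕ} {B : Tm}
    (hn : Γ[n]? = some B) :
    (n < k → Δ[n]? = some (B.subst a (k - (n + 1)))) ∧
    (n = k → HasType Δ (a.lift k 0) (B.lift k 0)) ∧ (k < n → Δ[n - 1]? = some B) := by
  induction h generalizing n with
  | zero h =>
    refine ⟨by simp, ?_, fun h => ?_⟩
    · rintro rfl
      simp only [List.getElem?_cons_zero, Option.some.injEq] at hn
      subst hn
      simpa [Tm.lift_zero] using h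
    · obtain ⟨m, rfl⟩ : ∃ m, n = m + 1 := ⟨n - 1, by omega⟩
      simpa using hn
  | @succ k Γ Δ C h ih =>
    cases n with
    | zero => simp_all
    | succ n =>
      have ⟨h₁, h₂, h₃⟩ := ih (n := n) (by simpa using hn)
      refine ⟨fun h => ?_, fun h => ?_, fun h => ?_⟩
      · simpa using h₁ (by omega)
      · have := (h₂ (by omega)).weaken [C.subst a k]
        simpa [Tm.lift_lift _ (Nat.zero_le _) (show 0 ≤ 0 + k by omega)] using this
      · obtain ⟨m, rfl⟩ : ∃ m, n = m + 1 := ⟨n - 1, by omega⟩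
        simpa using h₃ (by omega)

theorem HasType.replace {a A : Tm} {k : ℕ} {Γ Δ : List Tm} {t B : Tm} (h : HasType Γ t B)
    (i : Replace a A k Γ Δ) : HasType Δ (t.subst a k) (B.subst a k) := by
  induction h generalizing k Δ with
  | @var Γ n B hn =>
    have ⟨h₁, h₂, h₃⟩ := i.get hn
    simp only [Tm.subst]
    split_ifs with hk hk'
    · have e := Tm.subst_lift_comm B a (d := n + 1) (Nat.zero_le (k - (n + 1)))
      rw [Nat.sub_add_cancel hk] at e
      exact e ▸ .var (h₁ hk)
    · subst hk'
      rw [Tm.subst_lift _ _ (Nat.zero_le _) (by omega)]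
      exact h₂ rfl
    · rw [Tm.subst_lift _ _ (Nat.zero_le _) (by omega)]
      obtain ⟨m, rfl⟩ : ∃ m, n = m + 1 := ⟨n - 1, by omega⟩
      exact .var (h₃ (by omega))
  | univ Γ i => exact .univ _ _
  | cumul _ ih => exact .cumul (ih i)
  | pi _ _ ih ih' => exact .pi (ih i) (ih' (i.succ _))
  | lam _ _ ih ih' => exact .lam (ih i) (ih' (i.succ _))
  | @app Γ C B f b _ _ ih ih' =>
    have := Tm.subst_subst B b a 0 k
    rw [Nat.add_zero] at this
    rw [this]
    exact .app (ih i) (ih' i)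
  | cst Γ c => exact (c.subst_type a k).symm ▸ .cst _ c
  | conv _ _ c ih ih' => exact .conv (ih i) (ih' i) (c.subst a k)

theorem HasType.subst {Γ : List Tm} {a A t B : Tm} (h : HasType (A :: Γ) t B)
    (ha : HasType Γ a A) : HasType Γ (t.subst a 0) (B.subst a 0) := h.replace (.zero ha)

/-- Inversion on the subject of the judgement needs no confluence: the only other rules that can
type a product, cumulativity and conversion, keep the subject. -/
theorem HasType.pi_inv {Γ : List Tm} {A B T : Tm} (h : HasType Γ (.pi A B) T) :
    ∃ i, HasType Γ A (.univ i) ∧ HasType (A :: Γ) B (.univ i) := by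
  generalize hp : Tm.pi A B = p at h
  induction h with
  | pi h h' => cases hp; exact ⟨_, h, h'⟩
  | cumul _ ih => exact ih hp
  | conv _ _ _ ih => exact ih hp
  | _ => cases hp

theorem HasType.cumul_le {Γ : List Tm} {A : Tm} {i j : ℕ} (h : HasType Γ A (.univ i))
    (hij : i ≤ j) : HasType Γ A (.univ j) := by
  induction hij with
  | refl => exact h
  | step _ ih => exact ih.cumul

/-- A typable term has its free variables in the context. In the empty context this gives closedness
of the values of definitions. -/
theorem HasType.lift_eq {Γ : List Tm} {t A : Tm} (h : HasType Γ t A) (d : ℕ) {k : ℕ}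
    (hk : Γ.length ≤ k) : t.lift d k = t := by
  induction h generalizing k with
  | var hn =>
    have := (List.getElem?_eq_some_iff.1 hn).1
    simp [Tm.lift, this.trans_le hk]
  | univ | cst => rfl
  | cumul _ ih => exact ih hk
  | conv _ _ _ ih => exact ih hk
  | pi _ _ ih ih' => simp [Tm.lift, ih hk, ih' (Nat.succ_le_succ hk)]
  | lam _ _ _ ih => simp [Tm.lift, ih (Nat.succ_le_succ hk)]
  | app _ _ ih ih' => simp [Tm.lift, ih hk, ih' hk]

/-- The term `A` is a type. -/
def IsType (Γ : List Tm) (A : Tm) : Prop := ∃ i, HasType Γ A (.univ i)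

/-- All entries of the context are types. -/
inductive WfCtx : List Tm → Prop
  | nil : WfCtx []
  | cons {Γ : List Tm} {A : Tm} : WfCtx Γ → IsType Γ A → WfCtx (A :: Γ)

theorem WfCtx.get {Γ : List Tm} (h : WfCtx Γ) {n : ℕ} {A : Tm} (hn : Γ[n]? = some A) :
    IsType Γ (A.lift (n + 1) 0) := by
  induction h generalizing n with
  | nil => simp at hn
  | @cons Γ B _ hB ih =>
    cases n with
    | zero =>
      obtain ⟨i, hi⟩ := hB
      simp only [List.getElem?_cons_zero, Option.some.injEq] at hn
      exact ⟨i, hn ▸ hi.weaken [B]⟩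
    | succ n =>
      obtain ⟨i, hi⟩ := ih (n := n) (by simpa using hn)
      have := hi.weaken [B]
      rw [Tm.lift_lift _ (Nat.zero_le _) (by omega)] at this
      exact ⟨i, this⟩

/-! ### Instantiation of definitions -/

/-- Replace the variables of index at least `d` by the values of the definitions. -/
def Tm.inst (σ : ℕ → Tm) : Tm → ℕ → Tm
  | .var n, d => if n < d then .var n else σ (n - d)
  | .univ i, _ => .univ i
  | .pi A B, d => .pi (A.inst σ d) (B.inst σ (d + 1))
  | .lam b, d => .lam (b.inst σ (d + 1))
  | .app f a, d => .app (f.inst σ d) (a.inst σ d)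
  | .cst c, _ => .cst c

theorem Tm.inst_apps (σ : ℕ → Tm) (f : Tm) (l : List Tm) (d : ℕ) :
    (f.apps l).inst σ d = (f.inst σ d).apps (l.map fun t => t.inst σ d) := by
  induction l generalizing f with
  | nil => rfl
  | cons a l h => exact h _

theorem Cst.inst_type (σ : ℕ → Tm) (c : Cst) (d : ℕ) : c.type.inst σ d = c.type := by
  cases c <;> rfl

/-- The values of definitions are closed terms. -/
def ClosedVals (σ : ℕ → Tm) : Prop := ∀ k d m, (σ k).lift d m = σ k

section

variable {σ : ℕ → Tm} (hσ : ClosedVals σ)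

include hσ

theorem Tm.inst_lift (t : Tm) {d m k : ℕ} (h : k ≤ d) :
    (t.lift m k).inst σ (d + m) = (t.inst σ d).lift m k := by
  induction t generalizing d k with
  | var n =>
    simp only [Tm.lift, Tm.inst]
    split_ifs <;> simp only [Tm.lift, Tm.inst] <;> split_ifs <;> first
      | omega
      | rfl
      | (rw [hσ]; congr 1; omega)
  | pi A B hA hB =>
    have := hB (d := d + 1) (k := k + 1) (by omega)
    simp only [Tm.lift, Tm.inst, hA h, Nat.add_right_comm d m 1, this]
  | lam b hb =>
    have := hb (d := d + 1) (k := k + 1) (by omega)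
    simp only [Tm.lift, Tm.inst, Nat.add_right_comm d m 1, this]
  | app f a hf ha => simp [Tm.lift, Tm.inst, hf h, ha h]
  | _ => rfl

/-- Substitution does not touch the inserted values, because they are closed. This makes `β`-steps
survive instantiation. -/
theorem Tm.inst_subst (t s : Tm) (d k : ℕ) :
    (t.subst s k).inst σ (d + k) = (t.inst σ (d + k + 1)).subst (s.inst σ d) k := by
  have hs (n r m) : (σ n).subst r m = σ n := by
    conv_lhs => rw [← hσ n 1 m, Tm.subst_lift _ _ le_rfl (by omega), Tm.lift_zero]
  induction t generalizing k with
  | var n =>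
    simp only [Tm.subst, Tm.inst]
    split_ifs <;> (try simp only [Tm.subst, Tm.inst]) <;> (try split_ifs) <;> first
      | omega
      | rfl
      | exact Tm.inst_lift hσ s (Nat.zero_le _)
      | (rw [hs]; congr 1; omega)
  | pi A B hA hB =>
    have := hB (k + 1)
    simp only [Tm.subst, Tm.inst, hA, ← Nat.add_assoc] at this ⊢; rw [this]
  | lam b hb => have := hb (k + 1); simp only [Tm.subst, Tm.inst, ← Nat.add_assoc] at this ⊢; rw [this]
  | app f a hf ha => simp [Tm.subst, Tm.inst, hf, ha]
  | _ => rfl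

theorem Tm.inst_subst_zero (t s : Tm) (d : ℕ) :
    (t.subst s 0).inst σ d = (t.inst σ (d + 1)).subst (s.inst σ d) 0 := Tm.inst_subst hσ t s d 0

theorem Tm.inst_lift_zero (t : Tm) (d : ℕ) :
    (t.lift d 0).inst σ d = (t.inst σ 0).lift d 0 := by
  simpa using Tm.inst_lift hσ t (d := 0) (m := d) le_rfl

end

theorem lookup_eq (G : List Entry) (k : ℕ) : lookup G k = G[k]? := by
  induction G generalizing k with
  | nil => rfl
  | cons e G ih => cases k <;> simp [lookup, ih]

/-- The values `σ` of the definitions `G` are closed and have the given types. -/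
structure Sound (G : List Entry) (σ : ℕ → Tm) : Prop where
  closed : ClosedVals σ
  val {k : ℕ} {e : Entry} : lookup G k = some e → σ k = e.val.inst σ 0
  hasType {k : ℕ} {e : Entry} : lookup G k = some e → HasType [] (σ k) (e.type.inst σ 0)
  isType {k : ℕ} {e : Entry} : lookup G k = some e → IsType [] (e.type.inst σ 0)

theorem lookupVar_some {G : List Entry} {d k : ℕ} {e : Entry} (h : lookupVar G d k = some e) :
    d ≤ k ∧ lookup G (k - d) = some e := by
  unfold lookupVar at h
  cases hd : d.ble k <;> simp_all [Nat.ble_eq]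

/-- A definition and its unfolding become the same term after instantiation. Hence the calculus
needs no conversion rule for definitions. -/
theorem Sound.inst_val {G : List Entry} {σ : ℕ → Tm} (hσ : Sound G σ) {d k : ℕ} {e : Entry}
    (h : lookupVar G d k = some e) : (e.val.lift d 0).inst σ d = (Tm.var k).inst σ d := by
  obtain ⟨hd, h⟩ := lookupVar_some h
  rw [Tm.inst_lift_zero hσ.closed, ← hσ.val h, hσ.closed, Tm.inst, if_neg (by omega)]

/-! ### Soundness of the comparison of terms -/

theorem Cst.beq_eq {c d : Cst} (h : c.beq d) : c = d := by
  simp only [Cst.beq, Bool.and_eq_true, Nat.beq_eq] at h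
  obtain ⟨h₁, h₂, h₃⟩ := h
  cases c <;> cases d <;> simp_all [Cst.code]

theorem Tm.beq_eq {s t : Tm} (h : s.beq t) : s = t := by
  induction s generalizing t <;> cases t <;> simp_all [Tm.beq]
  case pi.pi hA hB _ _ => exact ⟨hA h.1, hB h.2⟩
  case lam.lam hb _ => exact hb h
  case app.app hf ha _ _ => exact ⟨hf h.1, ha h.2⟩
  case cst.cst => exact Cst.beq_eq h

/-! ### Soundness of reduction. -/

/-- The term that is given by a head and arguments, after instantiation. -/
def unspine (σ : ℕ → Tm) (d : ℕ) (s : Tm × List Tm) : Tm := (s.1.apps s.2).inst σ d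

theorem unspine_mk (σ : ℕ → Tm) (d : ℕ) (f : Tm) (l : List Tm) :
    unspine σ d (f, l) = (f.inst σ d).apps (l.map fun t => t.inst σ d) := Tm.inst_apps σ f l d

/-- The function `r` reduces terms to equal terms. -/
def RedSound (σ : ℕ → Tm) (d : ℕ) (r : Tm → List Tm → Tm × List Tm) : Prop :=
  ∀ t st, Conv (unspine σ d (t, st)) (unspine σ d (r t st))

theorem RedSound.of_eq {σ : ℕ → Tm} {d : ℕ} {r : Tm → List Tm → Tm × List Tm}
    (h : RedSound σ d r) {t : Tm} {s : Tm × List Tm} (e : r t [] = s) :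
    Conv (t.inst σ d) (unspine σ d s) := e ▸ h t []

section

variable {σ : ℕ → Tm} {d : ℕ} {r₀ r : Tm → List Tm → Tm × List Tm}

/-- The principal argument is first converted to a constructor by congruence; then the defining
equation applies. The type arguments and level of the constructor need not match those of the
eliminator, since the equations of `Conv` leave them free. The other eliminators are treated alike.
-/
theorem redSig_sound (h₀ : RedSound σ d r₀) (h : RedSound σ d r) (i j : ℕ) (st : List Tm) :
    Conv (unspine σ d (.cst (.sigElim i j), st))
      (unspine σ d (redSig r₀ r (.cst (.sigElim i j)) st)) := by
  unfold redSig
  split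
  · split
    · rename_i hp
      refine .trans ?_ (h _ _)
      have := h₀.of_eq hp
      simp only [unspine_mk, List.map_cons, List.map_nil] at this ⊢
      exact Conv.apps ((Conv.app (.refl _) this).trans (.sigElim _ _ _ _ _ _ _ _ _ _ _)) _
    · exact .refl _
  · exact .refl _

theorem redId_sound (h₀ : RedSound σ d r₀) (h : RedSound σ d r) (i j : ℕ) (st : List Tm) :
    Conv (unspine σ d (.cst (.idElim i j), st))
      (unspine σ d (redId r₀ r (.cst (.idElim i j)) st)) := by
  unfold redId
  split
  · split
    · rename_i hp
      refine .trans ?_ (h _ _)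
      have := h₀.of_eq hp
      simp only [unspine_mk, List.map_cons, List.map_nil] at this ⊢
      exact Conv.apps ((Conv.app (.refl _) this).trans (.idElim _ _ _ _ _ _ _ _ _ _)) _
    · exact .refl _
  · exact .refl _

theorem redFree_sound (h₀ : RedSound σ d r₀) (h : RedSound σ d r) (i j : ℕ) (st : List Tm) :
    Conv (unspine σ d (.cst (.freeElim i j), st))
      (unspine σ d (redFree r₀ r (.cst (.freeElim i j)) st)) := by
  unfold redFree
  split
  · split
    · rename_i hp
      refine .trans ?_ (h _ _)
      have := h₀.of_eq hp
      simp only [unspine_mk, List.map_cons, List.map_nil] at this ⊢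
      exact Conv.apps ((Conv.app (.refl _) this).trans
        (.freeElim_unit _ _ _ _ _ _ _ _ _ _ _ _)) _
    · rename_i hp
      refine .trans ?_ (h _ _)
      have := h₀.of_eq hp
      simp only [unspine_mk, List.map_cons, List.map_nil, Tm.inst_apps] at this ⊢
      exact Conv.apps ((Conv.app (.refl _) this).trans
        (.freeElim_cons _ _ _ _ _ _ _ _ _ _ _ _ _ _)) _
    · rename_i hp
      refine .trans ?_ (h _ _)
      have := h₀.of_eq hp
      simp only [unspine_mk, List.map_cons, List.map_nil, Tm.inst_apps] at this ⊢
      exact Conv.apps ((Conv.app (.refl _) this).trans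
        (.freeElim_icons _ _ _ _ _ _ _ _ _ _ _ _ _ _)) _
    · exact .refl _
  · exact .refl _

theorem redWedge_sound (h₀ : RedSound σ d r₀) (h : RedSound σ d r) (i j : ℕ) (st : List Tm) :
    Conv (unspine σ d (.cst (.wedgeElim i j), st))
      (unspine σ d (redWedge r₀ r (.cst (.wedgeElim i j)) st)) := by
  unfold redWedge
  split
  · split
    · rename_i hp
      refine .trans ?_ (h _ _)
      have := h₀.of_eq hp
      simp only [unspine_mk, List.map_cons, List.map_nil] at this ⊢
      exact Conv.apps ((Conv.app (.refl _) this).trans (.wedgeElim _ _ _ _ _ _ _ _)) _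
    · exact .refl _
  · exact .refl _

theorem redCst_sound (h₀ : RedSound σ d r₀) (h : RedSound σ d r) (c : Cst) (st : List Tm) :
    Conv (unspine σ d (.cst c, st)) (unspine σ d (redCst r₀ r c st)) := by
  cases c with
  | sigElim => exact redSig_sound h₀ h _ _ _
  | idElim => exact redId_sound h₀ h _ _ _
  | freeElim => exact redFree_sound h₀ h _ _ _
  | wedgeElim => exact redWedge_sound h₀ h _ _ _
  | _ => exact .refl _

theorem redLam_sound (hσ : ClosedVals σ) (h : RedSound σ d r) (b : Tm) (st : List Tm) :
    Conv (unspine σ d (.lam b, st)) (unspine σ d (redLam r b st)) := by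
  cases st with
  | nil => exact .refl _
  | cons a st =>
    refine .trans ?_ (h _ _)
    simp only [unspine_mk, Tm.inst_subst_zero hσ]
    exact Conv.apps (.beta _ _) _

end

/-- `Conv` is untyped, so no typing hypothesis is needed; when the fuel is used up, the term is
returned unchanged. -/
theorem red_sound {G : List Entry} {σ : ℕ → Tm} (hσ : Sound G σ) (d n : ℕ) (δ : Bool) :
    RedSound σ d (red G d n δ) := by
  induction n generalizing δ with
  | zero => exact fun _ _ => .refl _
  | succ n ih =>
    intro t st
    cases t with
    | app f a => exact ih δ f (a :: st)
    | lam b => exact redLam_sound hσ.closed (ih δ) b st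
    | cst c => exact redCst_sound (ih true) (ih δ) c st
    | var k =>
      simp only [red]
      cases he : (bif δ then lookupVar G d k else none) with
      | none => exact .refl _
      | some e =>
        refine .trans ?_ (ih δ _ _)
        cases δ with
        | false => simp at he
        | true => rw [unspine_mk, unspine_mk, hσ.inst_val he]; exact .refl _
    | _ => exact .refl _

theorem whnf_sound {G : List Entry} {σ : ℕ → Tm} (hσ : Sound G σ) (n d : ℕ) (t : Tm) :
    Conv (t.inst σ d) ((whnf G n d t).inst σ d) := red_sound hσ d n true t []

theorem betaNf_sound {σ : ℕ → Tm} (hσ : ClosedVals σ) (n d : ℕ) (t : Tm) (st : List Tm) :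
    Conv ((t.apps st).inst σ d) ((t.betaNf n st).inst σ d) := by
  -- Congruence for a whole list of arguments, needed for heads that do not reduce.
  have args {r : Tm → Tm} {d : ℕ} (h : ∀ a : Tm, Conv (a.inst σ d) ((r a).inst σ d)) (st : List Tm)
      {f f' : Tm} (hf : Conv f f') :
      Conv (f.apps (st.map fun a => a.inst σ d)) (f'.apps ((st.map r).map fun a => a.inst σ d)) := by
    induction st generalizing f f' with
    | nil => exact hf
    | cons a st ih => exact ih (hf.app (h a))
  induction n generalizing t st d with
  | zero => exact .refl _
  | succ n ih =>
    cases t with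
    | app f a => exact ih d f (a :: st)
    | lam b =>
      cases st with
      | nil => exact .lam (ih (d + 1) b [])
      | cons a st =>
        refine .trans ?_ (ih d _ _)
        simp only [Tm.inst_apps, Tm.inst_subst_zero hσ]
        exact Conv.apps (.beta _ _) _
    | pi A B =>
      simp only [Tm.betaNf, Tm.inst_apps]
      exact Conv.apps (.pi (ih d A []) (ih (d + 1) B [])) _
    | _ =>
      simp only [Tm.betaNf, Tm.inst_apps]
      exact args (fun a => ih d a []) st (.refl _)

/-! ### Soundness of the conversion test. -/

/-- The comparison `r` is sound. -/
def EqSound (σ : ℕ → Tm) (d : ℕ) (r : ℕ → Tm → Tm → Bool) : Prop :=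
  ∀ k s t, r k s t → Conv (s.inst σ (d + k)) (t.inst σ (d + k))

section

variable {σ : ℕ → Tm} {d : ℕ} {r : ℕ → Tm → Tm → Bool}

theorem headEq_sound (h : EqSound σ d r) {s t : Tm} (e : headEq r s t) :
    Conv (s.inst σ d) (t.inst σ d) := by
  cases s <;> cases t <;> simp [headEq] at e
  · rw [e]; exact .refl _
  · rw [e]; exact .refl _
  · exact .pi (h 0 _ _ e.1) (h 1 _ _ e.2)
  · exact .lam (h 1 _ _ e)
  · rw [Cst.beq_eq e]; exact .refl _

theorem all2_sound (h : EqSound σ d r) {l l' : List Tm} (e : all2 (r 0) l l') {s t : Tm}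
    (hs : Conv s t) : Conv (s.apps (l.map fun a => a.inst σ d)) (t.apps (l'.map fun a => a.inst σ d)) := by
  induction l generalizing l' s t with
  | nil => cases l' <;> simp_all [all2]; exact hs
  | cons a l ih =>
    cases l' with
    | nil => simp [all2] at e
    | cons a' l' =>
      simp only [all2, Bool.and_eq_true] at e
      exact ih e.2 (hs.app (h 0 _ _ e.1))

theorem spineEq_sound (h : EqSound σ d r) {s t : Tm × List Tm} (e : spineEq r s t) :
    Conv (unspine σ d s) (unspine σ d t) := by
  simp only [spineEq, Bool.and_eq_true] at e
  simp only [unspine, Tm.inst_apps]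
  exact all2_sound h e.2 (headEq_sound h e.1)

theorem inst_etaBody (hσ : ClosedVals σ) (t : Tm) :
    Conv (.lam (t.etaBody.inst σ (d + 1))) (t.inst σ d) := by
  simp only [Tm.etaBody, Tm.inst, Tm.inst_lift hσ t (Nat.zero_le d), Nat.zero_lt_succ, if_true]
  exact .eta _

theorem etaEq_sound (hσ : ClosedVals σ) (h : EqSound σ d r) {s t : Tm × List Tm}
    (e : etaEq r s t) : Conv (unspine σ d s) (unspine σ d t) := by
  unfold etaEq at e
  split at e
  · exact (Conv.lam (h 1 _ _ e)).trans (inst_etaBody hσ _)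
  · exact (inst_etaBody hσ _).symm.trans (.lam (h 1 _ _ e))
  · simp at e

end

theorem unfold_sound {G : List Entry} {σ : ℕ → Tm} (hσ : Sound G σ) (d : ℕ) (s : Tm × List Tm) :
    (unfold G d s).inst σ d = unspine σ d s := by
  unfold unfold
  split
  · split
    · rename_i he
      simp [unspine, Tm.inst_apps, hσ.inst_val he]
    · rfl
  · rfl

theorem whnfEq_sound {G : List Entry} {σ : ℕ → Tm} (hσ : Sound G σ) {d : ℕ}
    {r : ℕ → Tm → Tm → Bool} (h : EqSound σ d r) {s t : Tm × List Tm} (e : whnfEq G d r s t) :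
    Conv (unspine σ d s) (unspine σ d t) := by
  have hs := unfold_sound hσ d s
  have ht := unfold_sound hσ d t
  simp only [whnfEq, Bool.or_eq_true] at e
  rcases e with e | e
  · exact spineEq_sound h e
  · unfold stepEq at e
    cases h₁ : (height G d s.1).beq (height G d t.1) <;> simp only [h₁, cond_true, cond_false] at e
    · cases h₂ : (height G d s.1).ble (height G d t.1) <;>
        simp only [h₂, cond_true, cond_false] at e
      · rw [← hs]; exact h 0 _ _ e
      · rw [← ht]; exact h 0 _ _ e
    · cases h₂ : (height G d s.1).beq 0 <;> simp only [h₂, cond_true, cond_false] at e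
      · rw [← hs, ← ht]; exact h 0 _ _ e
      · exact etaEq_sound hσ.closed h e

/-- Both terms are convertible to their reducts, which are compared soundly. A lack of fuel gives
the answer `false`, about which nothing is claimed. -/
theorem conv_sound {G : List Entry} {σ : ℕ → Tm} (hσ : Sound G σ) (n : ℕ) {d : ℕ} {s t : Tm}
    (e : conv G n d s t) : Conv (s.inst σ d) (t.inst σ d) := by
  induction n generalizing d s t with
  | zero => simp [conv] at e
  | succ n ih =>
    simp only [conv, Bool.or_eq_true] at e
    rcases e with e | e
    · rw [Tm.beq_eq e]; exact .refl _
    · exact ((red_sound hσ d n false s []).trans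
        (whnfEq_sound hσ (fun k s t e => ih e) e)).trans (red_sound hσ d n false t []).symm

/-! ### Soundness of the type checker -/

/-- Instantiation of the definitions in a context. -/
def instCtx (σ : ℕ → Tm) : List Tm → List Tm
  | [] => []
  | A :: Γ => A.inst σ Γ.length :: instCtx σ Γ

theorem instCtx_length (σ : ℕ → Tm) (Γ : List Tm) : (instCtx σ Γ).length = Γ.length := by
  induction Γ <;> simp_all [instCtx]

theorem instCtx_get (σ : ℕ → Tm) {Γ : List Tm} {n : ℕ} {A : Tm} (h : Γ[n]? = some A) :
    (instCtx σ Γ)[n]? = some (A.inst σ (Γ.length - (n + 1))) := by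
  induction Γ generalizing n with
  | nil => simp at h
  | cons B Γ ih => cases n <;> simp_all [instCtx]

/-- The judgement `Γ ⊢ t : A` holds after instantiation, and `A` is a type. -/
def Typed (σ : ℕ → Tm) (Γ : List Tm) (t A : Tm) : Prop :=
  HasType (instCtx σ Γ) (t.inst σ Γ.length) (A.inst σ Γ.length) ∧
    IsType (instCtx σ Γ) (A.inst σ Γ.length)

/-- The judgement `Γ ⊢ A : U i` holds after instantiation. -/
def TypedAt (σ : ℕ → Tm) (Γ : List Tm) (A : Tm) (i : ℕ) : Prop :=
  HasType (instCtx σ Γ) (A.inst σ Γ.length) (.univ i)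

/-- The results of a type checker are correct. -/
structure CheckerSound (σ : ℕ → Tm) (r : Checker) : Prop where
  infer {Γ : List Tm} {t A : Tm} : WfCtx (instCtx σ Γ) → r Γ t none = some A → Typed σ Γ t A
  check {Γ : List Tm} {t A A' : Tm} {i : ℕ} : WfCtx (instCtx σ Γ) → TypedAt σ Γ A i →
    r Γ t (some A) = some A' → HasType (instCtx σ Γ) (t.inst σ Γ.length) (A.inst σ Γ.length)

theorem Tm.asUniv_eq {t : Tm} {i : ℕ} (h : t.asUniv = some i) : t = .univ i := by
  cases t <;> simp_all [Tm.asUniv]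

theorem Tm.asPi_eq {t : Tm} {p : Tm × Tm} (h : t.asPi = some p) : t = .pi p.1 p.2 := by
  cases t <;> simp_all [Tm.asPi]
  rw [← h]; exact ⟨rfl, rfl⟩

section

variable {G : List Entry} {σ : ℕ → Tm} (hσ : Sound G σ) {r : Checker} (hr : CheckerSound σ r)
  {Γ : List Tm} (hΓ : WfCtx (instCtx σ Γ)) {n : ℕ}

include hσ in
theorem asUniv_sound {d : ℕ} {S : Tm} {i : ℕ} (h : (whnf G n d S).asUniv = some i) :
    Conv (S.inst σ d) (.univ i) := by
  have := whnf_sound hσ n d S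
  rwa [Tm.asUniv_eq h] at this

include hσ hr hΓ

theorem levelOf_sound {A : Tm} {i : ℕ} (h : levelOf G n r Γ A = some i) : TypedAt σ Γ A i := by
  simp only [levelOf, Option.bind_eq_some_iff] at h
  obtain ⟨S, hS, h⟩ := h
  exact (hr.infer hΓ hS).1.conv (.univ _ i) (asUniv_sound hσ h)

/-- If `T` is literally a product, its parts are typed by inversion. Otherwise they come from
reduction, and the second run of the checker provides their typing. -/
theorem toPi_sound {T : Tm} {p : Tm × Tm} (h : toPi G n r Γ T = some p) {i : ℕ}
    (hT : TypedAt σ Γ T i) :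
    Conv (T.inst σ Γ.length) ((Tm.pi p.1 p.2).inst σ Γ.length) ∧
      ∃ j, TypedAt σ Γ p.1 j ∧ TypedAt σ (p.1 :: Γ) p.2 j := by
  unfold toPi at h
  split at h
  · rename_i q hq
    cases h
    rw [Tm.asPi_eq hq] at hT ⊢
    exact ⟨.refl _, HasType.pi_inv hT⟩
  · simp only [Option.bind_eq_some_iff, recheckPi, Option.map_eq_some_iff] at h
    obtain ⟨q, hq, j, hj, k, hk, rfl⟩ := h
    have hA := levelOf_sound hσ hr hΓ hj
    have hB := levelOf_sound hσ hr (Γ := q.1.betaNf n [] :: Γ) (.cons hΓ ⟨_, hA⟩) hk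
    -- The rule for products has one level for both parts, so cumulativity raises both to the
    -- maximum.
    refine ⟨?_, max j k, hA.cumul_le (le_max_left _ _), HasType.cumul_le hB (le_max_right _ _)⟩
    have := whnf_sound hσ n Γ.length T
    rw [Tm.asPi_eq hq] at this
    exact this.trans (.pi (betaNf_sound hσ.closed _ _ _ []) (betaNf_sound hσ.closed _ _ _ []))

theorem checkTm_sound {t T T' : Tm} {i : ℕ} (hT : TypedAt σ Γ T i)
    (h : checkTm G n r Γ t T = some T') :
    HasType (instCtx σ Γ) (t.inst σ Γ.length) (T.inst σ Γ.length) := by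
  unfold checkTm at h
  split at h
  · rename_i b
    simp only [checkLam, Option.bind_eq_some_iff, Option.map_eq_some_iff] at h
    obtain ⟨p, hp, S, hS, -⟩ := h
    obtain ⟨hc, j, hA, hB⟩ := toPi_sound hσ hr hΓ hp hT
    exact (HasType.lam hA (hr.check (Γ := p.1 :: Γ) (.cons hΓ ⟨_, hA⟩) hB hS)).conv hT hc.symm
  · simp only [checkInfer, Option.bind_eq_some_iff] at h
    obtain ⟨S, hS, h⟩ := h
    have ht := (hr.infer hΓ hS).1
    cases hs : subtype G n Γ.length S T with
    | false => simp [hs] at h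
    | true =>
      simp only [subtype, Bool.or_eq_true] at hs
      rcases hs with hs | hs
      · exact ht.conv hT (conv_sound hσ n hs)
      -- The remaining way to pass is by cumulativity: both types reduce to universes, and the
      -- inferred level is at most the expected one.
      · cases h₁ : (whnf G n Γ.length S).asUniv with
        | none => simp [h₁] at hs
        | some j =>
          cases h₂ : (whnf G n Γ.length T).asUniv with
          | none => simp [h₁, h₂] at hs
          | some k =>
            simp only [h₁, h₂, Option.bind_some, Option.map_some, Option.getD_some,
              Nat.ble_eq] at hs
            have := ht.conv (.univ _ j) (asUniv_sound hσ h₁)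
            exact (this.cumul_le hs).conv hT (asUniv_sound hσ h₂).symm

/-- An abstraction has no inferable type of its own, but in a redex the inferred type of the
argument serves as its domain. -/
theorem inferApp_sound {f a T : Tm} (h : inferApp G n r Γ f a = some T) :
    Typed σ Γ (.app f a) T := by
  unfold inferApp at h
  split at h
  · rename_i b
    simp only [inferRedex, Option.bind_eq_some_iff, Option.map_eq_some_iff] at h
    obtain ⟨A, hA, B, hB, rfl⟩ := h
    obtain ⟨ha, i, hA⟩ := hr.infer hΓ hA
    obtain ⟨hb, j, hB⟩ := hr.infer (Γ := A :: Γ) (.cons hΓ ⟨i, hA⟩) hB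
    have := Tm.inst_subst_zero hσ.closed B a Γ.length
    rw [Typed, this]
    exact ⟨.app (.lam hA hb) ha, j, hB.subst ha⟩
  · simp only [inferNeutral, Option.bind_eq_some_iff, Option.map_eq_some_iff] at h
    obtain ⟨S, hS, p, hp, S', hS', rfl⟩ := h
    obtain ⟨hf, i, hS⟩ := hr.infer hΓ hS
    obtain ⟨hc, j, hA, hB⟩ := toPi_sound hσ hr hΓ hp hS
    have ha := hr.check hΓ hA hS'
    have := Tm.inst_subst_zero hσ.closed p.2 a Γ.length
    rw [Typed, this]
    exact ⟨.app (hf.conv (.pi hA hB) hc) ha, j, HasType.subst hB ha⟩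

/-- The rule for constants does not require their types to be well formed, whereas `Typed` does;
`hok` supplies this. -/
theorem inferTm_sound {ok : Cst → Bool} (hok : ∀ c, ok c → IsType [] c.type) {t T : Tm}
    (h : inferTm G ok n r Γ t = some T) : Typed σ Γ t T := by
  cases t with
  | var k =>
    simp only [inferTm, inferVar] at h
    split at h
    · rename_i A hA
      cases h
      have hk := (List.getElem?_eq_some_iff.1 hA).1
      have h' := instCtx_get σ hA
      -- The entry `A` lives over the `Γ.length - (k + 1)` older variables, where it is instantiated
      -- in `instCtx`.
      have := Tm.inst_lift hσ.closed A (d := Γ.length - (k + 1)) (m := k + 1) (Nat.zero_le _)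
      rw [Nat.sub_add_cancel hk] at this
      rw [Typed, this, Tm.inst, if_pos hk]
      exact ⟨.var h', hΓ.get h'⟩
    · simp only [Option.map_eq_some_iff] at h
      obtain ⟨e, he, rfl⟩ := h
      obtain ⟨hd, he⟩ := lookupVar_some he
      rw [Typed, Tm.inst_lift_zero hσ.closed, Tm.inst, if_neg (by omega)]
      obtain ⟨i, hi⟩ := hσ.isType he
      have h₁ := (hσ.hasType he).weaken (instCtx σ Γ)
      have h₂ := hi.weaken (instCtx σ Γ)
      rw [List.append_nil, instCtx_length] at h₁ h₂
      rw [hσ.closed] at h₁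
      exact ⟨h₁, i, h₂⟩
  | univ i => cases h; exact ⟨.univ _ i, i + 2, .univ _ _⟩
  | pi A B =>
    simp only [inferTm, inferPi, Option.bind_eq_some_iff, Option.map_eq_some_iff] at h
    obtain ⟨i, hi, j, hj, rfl⟩ := h
    have hA := levelOf_sound hσ hr hΓ hi
    have hB := levelOf_sound hσ hr (Γ := A :: Γ) (.cons hΓ ⟨_, hA⟩) hj
    exact ⟨.pi (hA.cumul_le (le_max_left _ _)) (HasType.cumul_le hB (le_max_right _ _)),
      _, .univ _ _⟩
  | lam b => simp [inferTm] at h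
  | app f a => exact inferApp_sound hσ hr hΓ h
  | cst c =>
    simp only [inferTm] at h
    cases hc : ok c with
    | false => simp [hc] at h
    | true =>
      simp only [hc, cond_true, Option.some.injEq] at h
      subst h
      obtain ⟨i, hi⟩ := hok c hc
      have := hi.weaken (instCtx σ Γ)
      rw [c.lift_type, List.append_nil] at this
      rw [Typed, c.inst_type]
      exact ⟨.cst _ c, i, this⟩

end

theorem run_sound {G : List Entry} {σ : ℕ → Tm} (hσ : Sound G σ) {ok : Cst → Bool}
    (hok : ∀ c, ok c → IsType [] c.type) (n : ℕ) : CheckerSound σ (run G ok n) := by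
  induction n with
  | zero => constructor <;> simp [run]
  | succ n ih => exact ⟨fun hΓ h => inferTm_sound hσ ih hΓ hok h,
      fun hΓ hT h => checkTm_sound hσ ih hΓ hT h⟩

/-! ### The library of type-theoretic definitions: dependent sums. -/

/-- The `k`-th definition of the library. -/
def glob (k : ℕ) : Raw := fun n => .var (n + k)

/-- The second projection of `p : Sig i A B`. -/
def pr2 (i : ℕ) (A : Raw) (B : Raw → Raw) (p : Raw) : Raw :=
  cst (.sigElim i i) ⬝ A ⬝ lam B ⬝ (lam fun p => B (pr1 i A B p)) ⬝
    (lam fun _ => lam fun b => b) ⬝ p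

/-- A telescope of four types. -/
structure Tele where
  A : Raw
  B : Raw → Raw
  C : Raw → Raw → Raw
  D : Raw → Raw → Raw → Raw

namespace Tele

/-- The family of the types of the last two components. -/
def tail2 (i : ℕ) (t : Tele) (a b : Raw) : Raw := Sig i (t.C a b) fun c => t.D a b c

/-- The family of the types of the last three components. -/
def tail1 (i : ℕ) (t : Tele) (a : Raw) : Raw := Sig i (t.B a) fun b => t.tail2 i a b

/-- The iterated dependent sum of a telescope. -/
def type (i : ℕ) (t : Tele) : Raw := Sig i t.A fun a => t.tail1 i a

/-- A quadruple. -/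
def mk4 (i : ℕ) (t : Tele) (a b c d : Raw) : Raw :=
  pair i t.A (t.tail1 i) a <| pair i (t.B a) (t.tail2 i a) b <|
    pair i (t.C a b) (t.D a b) c d

/-- Elimination of a quadruple into a type `C`. -/
def elim4 (i j : ℕ) (t : Tele) (C : Raw) (f : Raw → Raw → Raw → Raw → Raw) (s : Raw) : Raw :=
  cst (.sigElim i j) ⬝ t.A ⬝ lam (t.tail1 i) ⬝ (lam fun _ => C) ⬝ (lam fun a => lam fun s =>
    cst (.sigElim i j) ⬝ t.B a ⬝ lam (t.tail2 i a) ⬝ (lam fun _ => C) ⬝ (lam fun b => lam fun s =>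
      cst (.sigElim i j) ⬝ t.C a b ⬝ lam (t.D a b) ⬝ (lam fun _ => C) ⬝
        (lam fun c => lam fun d => f a b c d) ⬝ s) ⬝ s) ⬝ s

/-- The definition `f`, applied to the telescope `t` and the quadruple `s`. -/
def proj (f : Raw) (t : Tele) (s : Raw) : Raw :=
  f ⬝ t.A ⬝ lam t.B ⬝ (lam fun a => lam fun b => t.C a b) ⬝
    (lam fun a => lam fun b => lam fun c => t.D a b c) ⬝ s

/-- The numbers after `glob`, here and later, are positions in `defs`. They count from the
beginning, so later definitions do not shift them. -/
def proj1 : Tele → Raw → Raw := proj (glob 0)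
def rest1 : Tele → Raw → Raw := proj (glob 1)
def proj2 : Tele → Raw → Raw := proj (glob 2)
def rest2 : Tele → Raw → Raw := proj (glob 3)
def proj3 : Tele → Raw → Raw := proj (glob 4)
def proj4 : Tele → Raw → Raw := proj (glob 5)

/-- The type of a dependent function on quadruples, for all telescopes. -/
def piType (T : Tele → Raw → Raw) : Raw :=
  pi (U 0) fun A => pi (A ⇒ U 0) fun B => pi (pi A fun a => B ⬝ a ⇒ U 0) fun C =>
  pi (pi A fun a => pi (B ⬝ a) fun b => C ⬝ a ⬝ b ⇒ U 0) fun D =>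
  let t : Tele := ⟨A, (B ⬝ ·), (C ⬝ · ⬝ ·), (D ⬝ · ⬝ · ⬝ ·)⟩
  pi (t.type 0) fun s => T t s

/-- A dependent function on quadruples, for all telescopes. -/
def lamTerm (f : Tele → Raw → Raw) : Raw :=
  lam fun A => lam fun B => lam fun C => lam fun D => lam fun s =>
    f ⟨A, (B ⬝ ·), (C ⬝ · ⬝ ·), (D ⬝ · ⬝ · ⬝ ·)⟩ s

end Tele

/-- A definition with its type, in named variables. -/
structure Def where
  type : Raw
  val : Raw

def proj1Def : Def where
  type := Tele.piType fun t _ => t.A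
  val := Tele.lamTerm fun t s => pr1 0 t.A (t.tail1 0) s

def rest1Def : Def where
  type := Tele.piType fun t s => t.tail1 0 (t.proj1 s)
  val := Tele.lamTerm fun t s => pr2 0 t.A (t.tail1 0) s

def proj2Def : Def where
  type := Tele.piType fun t s => t.B (t.proj1 s)
  val := Tele.lamTerm fun t s => pr1 0 (t.B (t.proj1 s)) (t.tail2 0 (t.proj1 s)) (t.rest1 s)

def rest2Def : Def where
  type := Tele.piType fun t s => t.tail2 0 (t.proj1 s) (t.proj2 s)
  val := Tele.lamTerm fun t s => pr2 0 (t.B (t.proj1 s)) (t.tail2 0 (t.proj1 s)) (t.rest1 s)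

def proj3Def : Def where
  type := Tele.piType fun t s => t.C (t.proj1 s) (t.proj2 s)
  val := Tele.lamTerm fun t s =>
    pr1 0 (t.C (t.proj1 s) (t.proj2 s)) (t.D (t.proj1 s) (t.proj2 s)) (t.rest2 s)

def proj4Def : Def where
  type := Tele.piType fun t s => t.D (t.proj1 s) (t.proj2 s) (t.proj3 s)
  val := Tele.lamTerm fun t s =>
    pr2 0 (t.C (t.proj1 s) (t.proj2 s)) (t.D (t.proj1 s) (t.proj2 s)) (t.rest2 s)

/-! ### Paths -/

/-- An identification `p : x =_A y`. -/
structure Path where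
  A : Raw
  x : Raw
  y : Raw
  p : Raw

namespace Path

/-- The type of an identification. -/
def type (p : Path) : Raw := Id 0 p.A p.x p.y

/-- Reflexivity. -/
def rfl (A x : Raw) : Path := ⟨A, x, x, refl 0 A x⟩

/-- The inverse of an identification. -/
def inv (p : Path) : Path := ⟨p.A, p.y, p.x, glob 6 ⬝ p.A ⬝ p.x ⬝ p.y ⬝ p.p⟩

/-- Concatenation. -/
def trans (p q : Path) : Path := ⟨p.A, p.x, q.y, glob 7 ⬝ p.A ⬝ p.x ⬝ p.y ⬝ q.y ⬝ p.p ⬝ q.p⟩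

/-- The action of a function. -/
def map (B f : Raw) (p : Path) : Path :=
  ⟨B, f ⬝ p.x, f ⬝ p.y, glob 8 ⬝ p.A ⬝ B ⬝ f ⬝ p.x ⬝ p.y ⬝ p.p⟩

/-- Path induction. -/
def ind (p : Path) (C : Raw → Raw → Raw) (c : Raw) : Raw := idElim 0 0 p.A p.x C c p.y p.p

/-- Transport. -/
def tr (p : Path) (C u : Raw) : Raw := glob 9 ⬝ p.A ⬝ C ⬝ p.x ⬝ p.y ⬝ p.p ⬝ u

/-- Identifications of identifications. -/
def eq (p q : Path) : Raw := Id 0 p.type p.p q.p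

/-- Reflexivity at an identification. -/
def rfl2 (p : Path) : Raw := refl 0 p.type p.p

end Path

/-- Product over an identification. -/
def piPath (A x y : Raw) (B : Path → Raw) : Raw := pi (Id 0 A x y) fun p => B ⟨A, x, y, p⟩

/-- Abstraction over an identification. -/
def lamPath (A x y : Raw) (b : Path → Raw) : Raw := lam fun p => b ⟨A, x, y, p⟩

def invDef : Def where
  type := pi (U 0) fun A => pi A fun x => pi A fun y => Id 0 A x y ⇒ Id 0 A y x
  val := lam fun A => lam fun x => lam fun y => lamPath A x y fun p =>
    p.ind (fun z _ => Id 0 A z x) (refl 0 A x)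

def transDef : Def where
  type := pi (U 0) fun A => pi A fun x => pi A fun y => pi A fun z =>
    Id 0 A x y ⇒ Id 0 A y z ⇒ Id 0 A x z
  val := lam fun A => lam fun x => lam fun y => lam fun z => lam fun p => lam fun q =>
    concat 0 A x y z p q

def apDef : Def where
  type := pi (U 0) fun A => pi (U 0) fun B => pi (A ⇒ B) fun f => pi A fun x => pi A fun y =>
    Id 0 A x y ⇒ Id 0 B (f ⬝ x) (f ⬝ y)
  val := lam fun A => lam fun B => lam fun f => lam fun x => lam fun y => lam fun p =>
    ap 0 0 A B (f ⬝ ·) x y p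

def trDef : Def where
  type := pi (U 0) fun A => pi (A ⇒ U 0) fun C => pi A fun x => pi A fun y =>
    Id 0 A x y ⇒ C ⬝ x ⇒ C ⬝ y
  val := lam fun A => lam fun C => lam fun x => lam fun y => lam fun p => lam fun u =>
    transport 0 0 A (C ⬝ ·) x y p u

/-- `p⁻¹⁻¹ = p`. -/
def invInvDef : Def where
  type := pi (U 0) fun A => pi A fun x => pi A fun y => piPath A x y fun p => p.inv.inv.eq p
  val := lam fun A => lam fun x => lam fun y => lamPath A x y fun p =>
    p.ind (fun z p => let p : Path := ⟨A, x, z, p⟩; p.inv.inv.eq p) (Path.rfl A x).rfl2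

/-- `refl = p⁻¹ · p`. -/
def invTransDef : Def where
  type := pi (U 0) fun A => pi A fun x => pi A fun y => piPath A x y fun p =>
    (Path.rfl A y).eq (p.inv.trans p)
  val := lam fun A => lam fun x => lam fun y => lamPath A x y fun p =>
    p.ind (fun z p => let p : Path := ⟨A, x, z, p⟩; (Path.rfl A z).eq (p.inv.trans p))
      (Path.rfl A x).rfl2

def invInv (p : Path) : Path := ⟨p.type, p.inv.inv.p, p.p, glob 10 ⬝ p.A ⬝ p.x ⬝ p.y ⬝ p.p⟩

def invTrans (p : Path) : Path :=
  ⟨Id 0 p.A p.y p.y, refl 0 p.A p.y, (p.inv.trans p).p, glob 11 ⬝ p.A ⬝ p.x ⬝ p.y ⬝ p.p⟩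

/-- `p · refl = p`. -/
def transReflDef : Def where
  type := pi (U 0) fun A => pi A fun x => pi A fun y => piPath A x y fun p =>
    (p.trans (Path.rfl A y)).eq p
  val := lam fun A => lam fun x => lam fun y => lamPath A x y fun p =>
    p.ind (fun z p => let p : Path := ⟨A, x, z, p⟩; (p.trans (Path.rfl A z)).eq p)
      (Path.rfl A x).rfl2

def transRefl (p : Path) : Path :=
  ⟨p.type, (p.trans (Path.rfl p.A p.y)).p, p.p, glob 12 ⬝ p.A ⬝ p.x ⬝ p.y ⬝ p.p⟩

/-- If `p · r = q · r` then `p = q`. -/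
def cancelRightDef : Def where
  type := pi (U 0) fun A => pi A fun x => pi A fun y => piPath A x y fun p => piPath A x y fun q =>
    pi A fun z => piPath A y z fun r => (p.trans r).eq (q.trans r) ⇒ p.eq q
  val := lam fun A => lam fun x => lam fun y => lamPath A x y fun p => lamPath A x y fun q =>
    lam fun z => lamPath A y z fun r => r.ind
      (fun z r => let r : Path := ⟨A, y, z, r⟩; (p.trans r).eq (q.trans r) ⇒ p.eq q)
      -- For r = refl the hypothesis reads p · refl = q · refl. Concatenation computes only in its
      -- first argument, so the right unit law is needed on both sides.
      (lamPath (Id 0 A x y) (transRefl p).x (transRefl q).x fun s =>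
        ((transRefl p).inv.trans (s.trans (transRefl q))).p)

/-! ### Equivalences -/

/-- The components of a proof that `f` is an equivalence. -/
def equivTele (i : ℕ) (A B f : Raw) : Tele where
  A := B ⇒ A
  B g := pi A fun x => Id i A (g ⬝ (f ⬝ x)) x
  C g _ := pi B fun y => Id i B (f ⬝ (g ⬝ y)) y
  D g η ε := pi A fun x => Id i (Id i B (f ⬝ (g ⬝ (f ⬝ x))) (f ⬝ x))
    (ap i i A B (f ⬝ ·) (g ⬝ (f ⬝ x)) x (η ⬝ x)) (ε ⬝ (f ⬝ x))

def isEquivDef : Def where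
  type := pi (U 0) fun X => pi (U 0) fun Y => (X ⇒ Y) ⇒ U 0
  val := lam fun X => lam fun Y => lam fun f => IsEquiv 0 X Y f

/-- The type of proofs that `f` is an equivalence. -/
def isEquiv (X Y f : Raw) : Raw := glob 14 ⬝ X ⬝ Y ⬝ f

def equivDef : Def where
  type := U 0 ⇒ U 0 ⇒ U 0
  val := lam fun X => lam fun Y => Equiv 0 X Y

/-- The type of equivalences. -/
def equiv (X Y : Raw) : Raw := glob 15 ⬝ X ⬝ Y

/-- A product over all equivalences. -/
def piIsEquiv (T : Raw → Raw → Raw → Raw → Raw) : Raw :=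
  pi (U 0) fun X => pi (U 0) fun Y => pi (X ⇒ Y) fun f => pi (isEquiv X Y f) fun h => T X Y f h

def lamIsEquiv (t : Raw → Raw → Raw → Raw → Raw) : Raw :=
  lam fun X => lam fun Y => lam fun f => lam fun h => t X Y f h

/-- The inverse of an equivalence. -/
def isEquivInv (X Y f h : Raw) : Raw := glob 16 ⬝ X ⬝ Y ⬝ f ⬝ h

def isEquivInvDef : Def where
  type := piIsEquiv fun X Y _ _ => Y ⇒ X
  val := lamIsEquiv fun X Y f h => (equivTele 0 X Y f).proj1 h

/-- The identification `g (f x) = x`, for the inverse `g` of `f`. -/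
def isEquivEta (X Y f h x : Raw) : Path :=
  ⟨X, isEquivInv X Y f h ⬝ (f ⬝ x), x, glob 17 ⬝ X ⬝ Y ⬝ f ⬝ h ⬝ x⟩

def isEquivEtaDef : Def where
  type := piIsEquiv fun X Y f h => pi X fun x => (isEquivEta X Y f h x).type
  val := lamIsEquiv fun X Y f h => (equivTele 0 X Y f).proj2 h

/-- The identification `f (g y) = y`, for the inverse `g` of `f`. -/
def isEquivEps (X Y f h y : Raw) : Path :=
  ⟨Y, f ⬝ (isEquivInv X Y f h ⬝ y), y, glob 18 ⬝ X ⬝ Y ⬝ f ⬝ h ⬝ y⟩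

def isEquivEpsDef : Def where
  type := piIsEquiv fun X Y f h => pi Y fun y => (isEquivEps X Y f h y).type
  val := lamIsEquiv fun X Y f h => (equivTele 0 X Y f).proj3 h

/-- The coherence of an equivalence. -/
def isEquivTau (X Y f h x : Raw) : Path :=
  let p := (isEquivEta X Y f h x).map Y f
  ⟨p.type, p.p, (isEquivEps X Y f h (f ⬝ x)).p, glob 19 ⬝ X ⬝ Y ⬝ f ⬝ h ⬝ x⟩

def isEquivTauDef : Def where
  type := piIsEquiv fun X Y f h => pi X fun x => (isEquivTau X Y f h x).type
  val := lamIsEquiv fun X Y f h => (equivTele 0 X Y f).proj4 h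

/-- The identity function is an equivalence. -/
def idIsEquivDef : Def where
  type := pi (U 0) fun X => isEquiv X X (lam fun x => x)
  val := lam fun X => (equivTele 0 X X (lam fun x => x)).mk4 0 (lam fun x => x)
    (lam fun x => refl 0 X x) (lam fun x => refl 0 X x)
    (lam fun x => refl 0 (Id 0 X x x) (refl 0 X x))

def idIsEquiv (X : Raw) : Raw := glob 20 ⬝ X

/-- The map underlying an equivalence. -/
def equivMap (X Y e : Raw) : Raw := glob 21 ⬝ X ⬝ Y ⬝ e

def equivMapDef : Def where
  type := pi (U 0) fun X => pi (U 0) fun Y => equiv X Y ⇒ X ⇒ Y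
  val := lam fun X => lam fun Y => lam fun e => Equiv.map 0 X Y e

def equivIsEquiv (X Y e : Raw) : Raw := glob 22 ⬝ X ⬝ Y ⬝ e

def equivIsEquivDef : Def where
  type := pi (U 0) fun X => pi (U 0) fun Y => pi (equiv X Y) fun e =>
    isEquiv X Y (equivMap X Y e)
  val := lam fun X => lam fun Y => lam fun e => pr2 0 (X ⇒ Y) (fun f => isEquiv X Y f) e

def idEquivDef : Def where
  type := pi (U 0) fun X => equiv X X
  val := lam fun X => Equiv.idEquiv 0 X

def idEquiv (X : Raw) : Raw := glob 23 ⬝ X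

/-- The map from identifications to equivalences. -/
def idToEq (X Y : Raw) : Raw := glob 24 ⬝ X ⬝ Y

def idToEqDef : Def where
  type := pi (U 0) fun X => pi (U 0) fun Y => Id 1 (U 0) X Y ⇒ equiv X Y
  val := lam fun X => lam fun Y => idToEquiv 0 X Y

/-- Induction over equivalences. -/
def equivIndDef : Def where
  type := pi (U 0) fun X => pi (pi (U 0) fun Y => equiv X Y ⇒ U 1) fun M =>
    M ⬝ X ⬝ idEquiv X ⇒ pi (U 0) fun Y => pi (equiv X Y) fun e => M ⬝ Y ⬝ e
  val := lam fun X => lam fun M => lam fun m => lam fun Y => lam fun e =>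
    -- Univalence gives a preimage g e of e under `idToEq`. Path induction on g e gives the motive
    -- at `idToEq (g e)`, and ε e transports it to e.
    (equivTele 1 (Id 1 (U 0) X Y) (equiv X Y) (idToEq X Y)).elim4 1 1 (M ⬝ Y ⬝ e)
      (fun g _ ε _ => transport 1 1 (equiv X Y) (fun e => M ⬝ Y ⬝ e)
        (idToEq X Y ⬝ (g ⬝ e)) e (ε ⬝ e)
        (idElim 1 1 (U 0) X (fun Z q => M ⬝ Z ⬝ (idToEq X Z ⬝ q)) m Y (g ⬝ e)))
      (cst (.univalence 0) ⬝ X ⬝ Y)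

def equivInd (X : Raw) (M : Raw → Raw → Raw) (m Y e : Raw) : Raw :=
  glob 25 ⬝ X ⬝ (lam fun Y => lam fun e => M Y e) ⬝ m ⬝ Y ⬝ e

/-- The function `X → Y` given by an identification of types. -/
def coe (X Y q u : Raw) : Raw := idElim 1 0 (U 0) X (fun Z _ => Z) u Y q

/-- The property of an identification `q : Y = X` to act as an inverse of `e : X ≃ Y`. -/
def uaFam (X Y e q : Raw) : Raw := pi X fun x => Id 0 X (coe Y X q (equivMap X Y e ⬝ x)) x

/-- Each equivalence is inverse to the action of an identification of types. -/
def uaInvDef : Def where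
  type := pi (U 0) fun X => pi (U 0) fun Y => pi (equiv X Y) fun e =>
    Sig 1 (Id 1 (U 0) Y X) (uaFam X Y e)
  val := lam fun X => lam fun Y => lam fun e =>
    -- For the identity equivalence, reflexivity works, since its action computes to the identity
    -- function.
    equivInd X (fun Y e => Sig 1 (Id 1 (U 0) Y X) (uaFam X Y e))
      (pair 1 (Id 1 (U 0) X X) (uaFam X X (idEquiv X)) (refl 1 (U 0) X)
        (lam fun x => refl 0 X x)) Y e

def uaInv (X Y e : Raw) : Raw := glob 26 ⬝ X ⬝ Y ⬝ e

/-- Homotopic functions are identified. -/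
def homotopyDef : Def where
  type := pi (U 0) fun A => pi (A ⇒ U 0) fun B => pi (pi A fun x => B ⬝ x) fun f =>
    pi (pi A fun x => B ⬝ x) fun g => (pi A fun x => Id 0 (B ⬝ x) (f ⬝ x) (g ⬝ x)) ⇒
    Id 0 (pi A fun x => B ⬝ x) f g
  val := lam fun A => lam fun B => lam fun f => lam fun g =>
    isEquivInv (Id 0 (pi A fun x => B ⬝ x) f g) (pi A fun x => Id 0 (B ⬝ x) (f ⬝ x) (g ⬝ x))
      (happly 0 A B f g) (cst (.funext 0) ⬝ A ⬝ B ⬝ f ⬝ g)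

def homotopy (A : Raw) (B : Raw → Raw) (f g h : Raw) : Raw :=
  glob 27 ⬝ A ⬝ lam B ⬝ f ⬝ g ⬝ h

/-- If `k` is homotopic to the identity by `H`, then `ap k (H x) = H (k x)`. -/
def apHomotopyDef : Def where
  type := pi (U 0) fun X => pi (X ⇒ X) fun k => pi (pi X fun x => Id 0 X (k ⬝ x) x) fun H =>
    pi X fun x => let h : Path := ⟨X, k ⬝ x, x, H ⬝ x⟩
      (h.map X k).eq ⟨X, k ⬝ (k ⬝ x), k ⬝ x, H ⬝ (k ⬝ x)⟩
  val := lam fun X => lam fun k => lam fun H => lam fun x =>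
    let h (x : Raw) : Path := ⟨X, k ⬝ x, x, H ⬝ x⟩
    let p := (h x).map X k
    let q := h (k ⬝ x)
    -- Naturality of H along the path H x itself gives ap k (H x) · H x = H (k x) · H x, and H x
    -- cancels.
    glob 13 ⬝ X ⬝ p.x ⬝ p.y ⬝ p.p ⬝ q.p ⬝ x ⬝ (h x).p ⬝
      ((h x).ind (fun z r => let r : Path := ⟨X, k ⬝ x, z, r⟩
          ((r.map X k).trans (h z)).eq ((h (k ⬝ x)).trans r))
        (transRefl (h (k ⬝ x))).inv.p)

/-- Let `ε` be a homotopy from `f ∘ g` to the identity. Then `ap f p` is the conjugate by `ε` of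
`ap f (ap (g ∘ f) p)`. -/
def apConjDef : Def where
  type := pi (U 0) fun X => pi (U 0) fun Y => pi (X ⇒ Y) fun f => pi (Y ⇒ X) fun g =>
    pi (pi Y fun y => Id 0 Y (f ⬝ (g ⬝ y)) y) fun ε => pi X fun x => pi X fun y =>
    piPath X x y fun p =>
    let e (y : Raw) : Path := ⟨Y, f ⬝ (g ⬝ y), y, ε ⬝ y⟩
    (p.map Y f).eq ((e (f ⬝ x)).inv.trans
      (((p.map X (lam fun z => g ⬝ (f ⬝ z))).map Y f).trans (e (f ⬝ y))))
  val := lam fun X => lam fun Y => lam fun f => lam fun g => lam fun ε => lam fun x => lam fun y =>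
    lamPath X x y fun p =>
    let e (y : Raw) : Path := ⟨Y, f ⬝ (g ⬝ y), y, ε ⬝ y⟩
    p.ind (fun y p => let p : Path := ⟨X, x, y, p⟩
      (p.map Y f).eq ((e (f ⬝ x)).inv.trans
        (((p.map X (lam fun z => g ⬝ (f ⬝ z))).map Y f).trans (e (f ⬝ y)))))
      (invTrans (e (f ⬝ x))).p

/-- A function with an inverse is an equivalence. -/
def adjointifyDef : Def where
  type := pi (U 0) fun X => pi (U 0) fun Y => pi (X ⇒ Y) fun f => pi (Y ⇒ X) fun g =>
    (pi X fun x => Id 0 X (g ⬝ (f ⬝ x)) x) ⇒ (pi Y fun y => Id 0 Y (f ⬝ (g ⬝ y)) y) ⇒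
    isEquiv X Y f
  val := lam fun X => lam fun Y => lam fun f => lam fun g => lam fun η => lam fun ε =>
    let h (x : Raw) : Path := ⟨X, g ⬝ (f ⬝ x), x, η ⬝ x⟩
    let e (y : Raw) : Path := ⟨Y, f ⬝ (g ⬝ y), y, ε ⬝ y⟩
    let gf (x : Raw) : Raw := g ⬝ (f ⬝ x)
    (equivTele 0 X Y f).mk4 0 g η
      -- The usual corrected homotopy ε(f g y)⁻¹ · ap f (η (g y)) · ε y. For the coherence, ap f (η
      -- x) is the conjugate of ap f (ap (g ∘ f) (η x)), and ap (g ∘ f) (η x) = η (g f x).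
      (lam fun y => ((e (f ⬝ (g ⬝ y))).inv.trans (((h (g ⬝ y)).map Y f).trans (e y))).p)
      (lam fun x =>
        let C (r : Raw) : Path := (e (f ⬝ gf x)).inv.trans
          ((Path.map Y f ⟨X, gf (gf x), gf x, r⟩).trans (e (f ⬝ x)))
        let p := (h x).map X (lam gf)
        Path.p <| Path.trans
          ⟨((h x).map Y f).type, ((h x).map Y f).p, (C p.p).p,
            glob 29 ⬝ X ⬝ Y ⬝ f ⬝ g ⬝ ε ⬝ gf x ⬝ x ⬝ (h x).p⟩
          (Path.map ((h x).map Y f).type (lam fun r => (C r).p)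
            ⟨p.type, p.p, (h (gf x)).p, glob 28 ⬝ X ⬝ lam gf ⬝ η ⬝ x⟩))

/-- Concatenation with an identification is an equivalence. -/
def transIsEquivDef : Def where
  type := pi (U 0) fun X => pi X fun x => pi X fun y => pi X fun z => piPath X x y fun p =>
    isEquiv (Id 0 X y z) (Id 0 X x z) (lamPath X y z fun q => (p.trans q).p)
  val := lam fun X => lam fun x => lam fun y => lam fun z => lamPath X x y fun p =>
    p.ind (fun y p => isEquiv (Id 0 X y z) (Id 0 X x z)
        (lamPath X y z fun q => (Path.trans ⟨X, x, y, p⟩ q).p))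
      -- Concatenation with refl on the left computes to the identity function.
      (idIsEquiv (Id 0 X x z))

def transIsEquiv (p : Path) (z : Raw) : Raw := glob 31 ⬝ p.A ⬝ p.x ⬝ p.y ⬝ z ⬝ p.p

/-- If `ap f p = l`, then `ap f (p · q) = l · ap f q`. -/
def apTransDef : Def where
  type := pi (U 0) fun X => pi (U 0) fun Y => pi (X ⇒ Y) fun f =>
    pi X fun x => pi X fun y => pi X fun z => piPath X x y fun p =>
    piPath Y (f ⬝ x) (f ⬝ y) fun l => (p.map Y f).eq l ⇒
    piPath X y z fun q => ((p.trans q).map Y f).eq (l.trans (q.map Y f))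
  val := lam fun X => lam fun Y => lam fun f => lam fun x => lam fun y => lam fun z =>
    lamPath X x y fun p => lamPath Y (f ⬝ x) (f ⬝ y) fun l =>
    lamPath (p.map Y f).type (p.map Y f).p l.p fun α => lamPath X y z fun q =>
    α.ind (fun l _ => ((p.trans q).map Y f).eq (Path.trans ⟨Y, f ⬝ x, f ⬝ y, l⟩ (q.map Y f)))
      (p.ind (fun y p => let p : Path := ⟨X, x, y, p⟩
        piPath X y z fun q => ((p.trans q).map Y f).eq ((p.map Y f).trans (q.map Y f)))
        (lamPath X x z fun q => (q.map Y f).rfl2) ⬝ q.p)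

/-! ### Families of types -/

/-- The identification `transport p Y = Z` in the universe given by `q : Y = Z`. -/
def constPath (p : Path) (Y Z q : Raw) : Raw :=
  idElim 0 1 p.A p.x (fun y p' => Id 1 (U 0) (transport 0 1 p.A (fun _ => U 0) p.x y p' Y) Z)
    q p.y p.p

/-- If the action of the family `C` on `p : x = y` is `q : C x = C y`, then transport along `p`
is the function given by `q`. -/
def transportCoeDef : Def where
  type := pi (U 0) fun X => pi (X ⇒ U 0) fun C => pi X fun x => pi X fun y =>
    piPath X x y fun p => pi (Id 1 (U 0) (C ⬝ x) (C ⬝ y)) fun q =>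
    Id 1 (Id 1 (U 0) (transport 0 1 X (fun _ => U 0) x y p.p (C ⬝ x)) (C ⬝ y))
      (apd 0 1 X (fun _ => U 0) (C ⬝ ·) x y p.p) (constPath p (C ⬝ x) (C ⬝ y) q) ⇒
    pi (C ⬝ x) fun u => Id 0 (C ⬝ y) (p.tr C u) (coe (C ⬝ x) (C ⬝ y) q u)
  val := lam fun X => lam fun C => lam fun x => lam fun y => lamPath X x y fun p =>
    idElim 0 1 X x (fun y p => let p : Path := ⟨X, x, y, p⟩
        pi (Id 1 (U 0) (C ⬝ x) (C ⬝ y)) fun q =>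
        Id 1 (Id 1 (U 0) (transport 0 1 X (fun _ => U 0) x y p.p (C ⬝ x)) (C ⬝ y))
          (apd 0 1 X (fun _ => U 0) (C ⬝ ·) x y p.p) (constPath p (C ⬝ x) (C ⬝ y) q) ⇒
        pi (C ⬝ x) fun u => Id 0 (C ⬝ y) (p.tr C u) (coe (C ⬝ x) (C ⬝ y) q u))
      -- At p = refl both `apd` and `constPath` compute, so the hypothesis becomes refl = q, on
      -- which path induction applies.
      (lam fun q => lam fun h => lam fun u =>
        idElim 1 0 (Id 1 (U 0) (C ⬝ x) (C ⬝ x)) (refl 1 (U 0) (C ⬝ x))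
          (fun q _ => Id 0 (C ⬝ x) u (coe (C ⬝ x) (C ⬝ x) q u)) (refl 0 (C ⬝ x) u) q h)
      y p.p

/-- The total space of a family. -/
def tot (X C : Raw) : Raw := cst (.sig 0) ⬝ X ⬝ C

/-- A pair in the total space of a family. -/
def pr (X C x u : Raw) : Raw := cst (.pair 0) ⬝ X ⬝ C ⬝ x ⬝ u

def fstDef : Def where
  type := pi (U 0) fun X => pi (X ⇒ U 0) fun C => tot X C ⇒ X
  val := lam fun X => lam fun C => lam fun t => pr1 0 X (C ⬝ ·) t

/-- The projection of a total space to the base. -/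
def fst (X C : Raw) : Raw := glob 34 ⬝ X ⬝ C

def sndDef : Def where
  type := pi (U 0) fun X => pi (X ⇒ U 0) fun C => pi (tot X C) fun t => C ⬝ (fst X C ⬝ t)
  val := lam fun X => lam fun C => lam fun t => pr2 0 X (C ⬝ ·) t

/-- The second component of an element of a total space. -/
def scd (X C t : Raw) : Raw := glob 35 ⬝ X ⬝ C ⬝ t

/-- An identification of pairs. -/
def pairPathDef : Def where
  type := pi (U 0) fun X => pi (X ⇒ U 0) fun C => pi X fun x => pi X fun y =>
    piPath X x y fun p => pi (C ⬝ x) fun u => pi (C ⬝ y) fun v =>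
    Id 0 (C ⬝ y) (p.tr C u) v ⇒ Id 0 (tot X C) (pr X C x u) (pr X C y v)
  val := lam fun X => lam fun C => lam fun x => lam fun y => lamPath X x y fun p =>
    p.ind (fun y p => let p : Path := ⟨X, x, y, p⟩
        pi (C ⬝ x) fun u => pi (C ⬝ y) fun v =>
        Id 0 (C ⬝ y) (p.tr C u) v ⇒ Id 0 (tot X C) (pr X C x u) (pr X C y v))
      (lam fun u => lam fun v => lamPath (C ⬝ x) u v fun r =>
        r.ind (fun v _ => Id 0 (tot X C) (pr X C x u) (pr X C x v))
          (refl 0 (tot X C) (pr X C x u)))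

def pairPath (C : Raw) (p : Path) (u v r : Raw) : Path :=
  ⟨tot p.A C, pr p.A C p.x u, pr p.A C p.y v,
    glob 36 ⬝ p.A ⬝ C ⬝ p.x ⬝ p.y ⬝ p.p ⬝ u ⬝ v ⬝ r⟩

/-- The projection of an identification of pairs. -/
def apFstDef : Def where
  type := pi (U 0) fun X => pi (X ⇒ U 0) fun C => pi X fun x => pi X fun y =>
    piPath X x y fun p => pi (C ⬝ x) fun u => pi (C ⬝ y) fun v =>
    piPath (C ⬝ y) (p.tr C u) v fun r =>
    Id 0 p.type ((pairPath C p u v r.p).map X (fst X C)).p p.p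
  val := lam fun X => lam fun C => lam fun x => lam fun y => lamPath X x y fun p =>
    p.ind (fun y p => let p : Path := ⟨X, x, y, p⟩
        pi (C ⬝ x) fun u => pi (C ⬝ y) fun v => piPath (C ⬝ y) (p.tr C u) v fun r =>
        Id 0 p.type ((pairPath C p u v r.p).map X (fst X C)).p p.p)
      (lam fun u => lam fun v => lamPath (C ⬝ x) u v fun r =>
        r.ind (fun v r => Id 0 (Id 0 X x x)
          ((pairPath C (Path.rfl X x) u v r).map X (fst X C)).p (refl 0 X x))
          (Path.rfl X x).rfl2)

/-- Concatenation with an identification of pairs `(x, u) = (y, v)` does not depend on the choice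
of `v`. -/
def pairPathTransDef : Def where
  type := pi (U 0) fun X => pi (X ⇒ U 0) fun C => pi X fun x => pi X fun y =>
    piPath X x y fun p => pi (C ⬝ x) fun u => pi (tot X C) fun t =>
    pi (pi (C ⬝ y) fun v => Id 0 (tot X C) (pr X C y v) t) fun f => pi (C ⬝ y) fun v =>
    piPath (C ⬝ y) (p.tr C u) v fun r =>
    let w := p.tr C u
    let f (v : Raw) : Path := ⟨tot X C, pr X C y v, t, f ⬝ v⟩
    ((pairPath C p u v r.p).trans (f v)).eq
      ((pairPath C p u w (refl 0 (C ⬝ y) w)).trans (f w))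
  val := lam fun X => lam fun C => lam fun x => lam fun y => lamPath X x y fun p =>
    lam fun u => lam fun t => lam fun f => lam fun v =>
    lamPath (C ⬝ y) (p.tr C u) v fun r =>
    let w := p.tr C u
    let f (v : Raw) : Path := ⟨tot X C, pr X C y v, t, f ⬝ v⟩
    let q := (pairPath C p u w (refl 0 (C ⬝ y) w)).trans (f w)
    r.ind (fun v r => ((pairPath C p u v r).trans (f v)).eq q) q.rfl2

/-- Transport in the family of the functions that give for each element of `C y` an
identification with `t` in the total space. -/
def transportPiDef : Def where
  type := pi (U 0) fun X => pi (X ⇒ U 0) fun C => pi X fun x => pi X fun y =>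
    piPath X x y fun p => pi (tot X C) fun t =>
    let P (y : Raw) : Raw := pi (C ⬝ y) fun v => Id 0 (tot X C) (pr X C y v) t
    pi (P x) fun f => pi (P y) fun g =>
    (pi (C ⬝ x) fun u =>
      let v := p.tr C u
      Id 0 (Id 0 (tot X C) (pr X C x u) t) (f ⬝ u) (Path.trans
        (pairPath C p u v (refl 0 (C ⬝ y) v)) ⟨tot X C, pr X C y v, t, g ⬝ v⟩).p) ⇒
    Id 0 (P y) (p.tr (lam P) f) g
  val := lam fun X => lam fun C => lam fun x => lam fun y => lamPath X x y fun p => lam fun t =>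
    let P (y : Raw) : Raw := pi (C ⬝ y) fun v => Id 0 (tot X C) (pr X C y v) t
    p.ind (fun y p => let p : Path := ⟨X, x, y, p⟩
        pi (P x) fun f => pi (P y) fun g =>
        (pi (C ⬝ x) fun u =>
          let v := p.tr C u
          Id 0 (Id 0 (tot X C) (pr X C x u) t) (f ⬝ u) (Path.trans
            (pairPath C p u v (refl 0 (C ⬝ y) v)) ⟨tot X C, pr X C y v, t, g ⬝ v⟩).p) ⇒
        Id 0 (P y) (p.tr (lam P) f) g)
      -- At p = refl the path of pairs computes to refl, so the hypothesis is a homotopy from f to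
      -- g, and function extensionality finishes.
      (lam fun f => lam fun g => lam fun h =>
        homotopy (C ⬝ x) (fun u => Id 0 (tot X C) (pr X C x u) t) f g h)

/-- The identification `transport p⁻¹ v = u` for an identification `(x, u) = (y, v)` with first
component `p`. -/
def transportFstDef : Def where
  type := pi (U 0) fun X => pi (X ⇒ U 0) fun C => pi (tot X C) fun s => pi (tot X C) fun t =>
    piPath (tot X C) s t fun p =>
    Id 0 (C ⬝ (fst X C ⬝ s)) ((p.map X (fst X C)).inv.tr C (scd X C t)) (scd X C s)
  val := lam fun X => lam fun C => lam fun s => lam fun t => lamPath (tot X C) s t fun p =>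
    p.ind (fun t p => let p : Path := ⟨tot X C, s, t, p⟩
        Id 0 (C ⬝ (fst X C ⬝ s)) ((p.map X (fst X C)).inv.tr C (scd X C t)) (scd X C s))
      (refl 0 (C ⬝ (fst X C ⬝ s)) (scd X C s))

/-! ### Lifting an equivalence to families -/

/-- `apOver` for a function `k` from `X` to `Y` and families `P` over `X` and `Q` over `Y`. -/
def apOverDef : Def where
  type := pi (U 0) fun X => pi (X ⇒ U 0) fun P => pi (U 0) fun Y => pi (Y ⇒ U 0) fun Q =>
    pi (X ⇒ Y) fun k => pi (pi X fun x => P ⬝ x ⇒ Q ⬝ (k ⬝ x)) fun h =>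
    pi X fun x => pi (P ⬝ x) fun u => pi X fun z => piPath X x z fun q => pi (P ⬝ z) fun v =>
    Id 0 (P ⬝ z) (q.tr P u) v ⇒ Id 0 (Q ⬝ (k ⬝ z)) ((q.map Y k).tr Q (h ⬝ x ⬝ u)) (h ⬝ z ⬝ v)
  val := lam fun X => lam fun P => lam fun Y => lam fun Q => lam fun k => lam fun h =>
    lam fun x => lam fun u => lam fun z => lam fun q => lam fun v => lam fun r =>
    idElim 0 0 X x (fun z q =>
        pi (P ⬝ z) fun v => Id 0 (P ⬝ z) (transport 0 0 X (P ⬝ ·) x z q u) v ⇒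
          Id 0 (Q ⬝ (k ⬝ z))
            (transport 0 0 Y (Q ⬝ ·) (k ⬝ x) (k ⬝ z) (ap 0 0 X Y (k ⬝ ·) x z q) (h ⬝ x ⬝ u))
            (h ⬝ z ⬝ v))
      (lam fun v => lam fun r => ap 0 0 (P ⬝ x) (Q ⬝ (k ⬝ x)) (h ⬝ x ⬝ ·) u v r) z q ⬝ v ⬝ r

/-- The data of a map of families over an equivalence. -/
structure Over where
  X : Raw
  P : Raw
  Y : Raw
  e : Raw
  Q : Raw
  h : Raw

namespace Over

/-- The map underlying the equivalence. -/
def k (o : Over) : Raw := glob 21 ⬝ o.X ⬝ o.Y ⬝ o.e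

/-- The inverse of the equivalence. -/
def g (o : Over) : Raw := isEquivInv o.X o.Y o.k (equivIsEquiv o.X o.Y o.e)

def η (o : Over) : Raw → Path := isEquivEta o.X o.Y o.k (equivIsEquiv o.X o.Y o.e)

def ε (o : Over) : Raw → Path := isEquivEps o.X o.Y o.k (equivIsEquiv o.X o.Y o.e)

def τ (o : Over) : Raw → Path := isEquivTau o.X o.Y o.k (equivIsEquiv o.X o.Y o.e)

/-- The definition `f`, applied to the data. -/
def app (o : Over) (f : Raw) : Raw := f ⬝ o.X ⬝ o.P ⬝ o.Y ⬝ o.e ⬝ o.Q ⬝ o.h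

/-- A product over all data. -/
def piType (T : Over → Raw) : Raw :=
  pi (U 0) fun X => pi (X ⇒ U 0) fun P => pi (U 0) fun Y => pi (equiv X Y) fun e =>
  pi (Y ⇒ U 0) fun Q => pi (pi X fun x => P ⬝ x ⇒ Q ⬝ (equivMap X Y e ⬝ x)) fun h =>
  T ⟨X, P, Y, e, Q, h⟩

def lamTerm (t : Over → Raw) : Raw :=
  lam fun X => lam fun P => lam fun Y => lam fun e => lam fun Q => lam fun h => t ⟨X, P, Y, e, Q, h⟩

/-- The type of the inverse map of families. -/
def invType (o : Over) : Raw := pi o.Y fun y => o.Q ⬝ y ⇒ o.P ⬝ (o.g ⬝ y)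

def etaType (o : Over) (d : Raw) : Raw := pi o.X fun x => pi (o.P ⬝ x) fun u =>
  Id 0 (o.P ⬝ x) ((o.η x).tr o.P (d ⬝ (o.k ⬝ x) ⬝ (o.h ⬝ x ⬝ u))) u

def epsType (o : Over) (d : Raw) : Raw := pi o.Y fun y => pi (o.Q ⬝ y) fun v =>
  Id 0 (o.Q ⬝ y) ((o.ε y).tr o.Q (o.h ⬝ (o.g ⬝ y) ⬝ (d ⬝ y ⬝ v))) v

def tauType (o : Over) (d m n : Raw) : Raw := pi o.X fun x => pi (o.P ⬝ x) fun u =>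
  let x' := o.g ⬝ (o.k ⬝ x)
  let u' := d ⬝ (o.k ⬝ x) ⬝ (o.h ⬝ x ⬝ u)
  let T (q : Raw) : Raw := Id 0 (o.Q ⬝ (o.k ⬝ x))
    (Path.tr ⟨o.Y, o.k ⬝ x', o.k ⬝ x, q⟩ o.Q (o.h ⬝ x' ⬝ u')) (o.h ⬝ x ⬝ u)
  Id 0 (T (o.τ x).y)
    ((o.τ x).tr (lam T) (glob 41 ⬝ o.X ⬝ o.P ⬝ o.Y ⬝ o.Q ⬝ o.k ⬝ o.h ⬝ x' ⬝ u' ⬝ x ⬝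
      (o.η x).p ⬝ u ⬝ (m ⬝ x ⬝ u)))
    (n ⬝ (o.k ⬝ x) ⬝ (o.h ⬝ x ⬝ u))

end Over

def invTypeDef : Def where
  type := Over.piType fun _ => U 0
  val := Over.lamTerm fun o => o.invType

def etaTypeDef : Def where
  type := Over.piType fun o => o.app (glob 42) ⇒ U 0
  val := Over.lamTerm fun o => lam fun d => o.etaType d

def epsTypeDef : Def where
  type := Over.piType fun o => o.app (glob 42) ⇒ U 0
  val := Over.lamTerm fun o => lam fun d => o.epsType d

def tauTypeDef : Def where
  type := Over.piType fun o => pi (o.app (glob 42)) fun d =>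
    o.app (glob 43) ⬝ d ⇒ o.app (glob 44) ⬝ d ⇒ U 0
  val := Over.lamTerm fun o => lam fun d => lam fun m => lam fun n => o.tauType d m n

/-- The structure of an inverse over the equivalence `e : X ≃ Y` of a map `h` from the family `P`
over `X` to the family `Q` over `Y`. -/
def invOverTele (o : Over) : Tele where
  A := o.app (glob 42)
  B d := o.app (glob 43) ⬝ d
  C d _ := o.app (glob 44) ⬝ d
  D d m n := o.app (glob 45) ⬝ d ⬝ m ⬝ n

/-- A map of families over an equivalence that consists of equivalences has an inverse. -/
def invOverDef : Def where
  type := pi (U 0) fun X => pi (X ⇒ U 0) fun P => pi (U 0) fun Y => pi (equiv X Y) fun e =>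
    pi (Y ⇒ U 0) fun Q => pi (pi X fun x => P ⬝ x ⇒ Q ⬝ (equivMap X Y e ⬝ x)) fun h =>
    (pi X fun x => isEquiv (P ⬝ x) (Q ⬝ (equivMap X Y e ⬝ x)) (h ⬝ x)) ⇒
    (invOverTele ⟨X, P, Y, e, Q, h⟩).type 0
  val := lam fun X => lam fun P => lam fun Y => lam fun e =>
    equivInd X (fun Y e =>
        pi (Y ⇒ U 0) fun Q => pi (pi X fun x => P ⬝ x ⇒ Q ⬝ (equivMap X Y e ⬝ x)) fun h =>
        (pi X fun x => isEquiv (P ⬝ x) (Q ⬝ (equivMap X Y e ⬝ x)) (h ⬝ x)) ⇒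
        (invOverTele ⟨X, P, Y, e, Q, h⟩).type 0)
      -- Over the identity equivalence all base paths are refl and transport computes away. What
      -- remains is the inverse, the two homotopies and the coherence of the equivalence h x, fiber
      -- by fiber.
      (lam fun Q => lam fun h => lam fun hE =>
        let f (c x : Raw) : Raw := c ⬝ (P ⬝ x) ⬝ (Q ⬝ x) ⬝ (h ⬝ x) ⬝ (hE ⬝ x)
        (invOverTele ⟨X, P, X, idEquiv X, Q, h⟩).mk4 0
          (lam (f (glob 16))) (lam (f (glob 17)))
          (lam (f (glob 18))) (lam (f (glob 19))))
      Y e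

/-! ### The free higher group -/

/-- The equivalence `cons_a`. -/
def consEquivDef : Def where
  type := pi (U 0) fun A => pi A fun _ => equiv (F 0 A) (F 0 A)
  val := lam fun A => lam fun a =>
    pair 0 (F 0 A ⇒ F 0 A) (isEquiv (F 0 A) (F 0 A)) (cons 0 A a)
      ((equivTele 0 (F 0 A) (F 0 A) (cons 0 A a)).mk4 0 (icons 0 A a)
        (cst (.mu1 0) ⬝ A ⬝ a) (cst (.mu2 0) ⬝ A ⬝ a) (cst (.mu 0) ⬝ A ⬝ a))

def consEquiv (A a : Raw) : Raw := glob 47 ⬝ A ⬝ a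

/-- Induction over the free higher group, for families on which each `cons_a` acts by
equivalences. -/
def freeIndDef : Def where
  type := pi (U 0) fun A => pi (F 0 A ⇒ U 0) fun P => P ⬝ unit 0 A ⇒
    pi (pi A fun a => pi (F 0 A) fun x => P ⬝ x ⇒ P ⬝ (cons 0 A a ⬝ x)) fun h =>
    (pi A fun a => pi (F 0 A) fun x => isEquiv (P ⬝ x) (P ⬝ (cons 0 A a ⬝ x)) (h ⬝ a ⬝ x)) ⇒
    pi (F 0 A) fun x => P ⬝ x
  val := lam fun A => lam fun P => lam fun u => lam fun h => lam fun hE =>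
    let t (a : Raw) : Tele := invOverTele ⟨F 0 A, P, F 0 A, consEquiv A a, P, h ⬝ a⟩
    let s (a : Raw) : Raw :=
      glob 46 ⬝ F 0 A ⬝ P ⬝ F 0 A ⬝ consEquiv A a ⬝ P ⬝ (h ⬝ a) ⬝ (hE ⬝ a)
    -- The methods for `icons`, `mu1`, `mu2` and `mu` are the four components of the inverse of h a
    -- over the equivalence `cons_a`. Since h itself is the method for `cons`, the result computes
    -- on `cons_a x`.
    cst (.freeElim 0 0) ⬝ A ⬝ P ⬝ u ⬝ h ⬝ (lam fun a => (t a).proj1 (s a)) ⬝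
      (lam fun a => (t a).proj2 (s a)) ⬝ (lam fun a => (t a).proj3 (s a)) ⬝
      (lam fun a => (t a).proj4 (s a))

/-! ### The universal cover of the wedge of circles -/

/-- The identification of types that is inverse to `cons_a`. -/
def consPathDef : Def where
  type := pi (U 0) fun A => pi A fun _ => Id 1 (U 0) (F 0 A) (F 0 A)
  val := lam fun A => lam fun a =>
    pr1 1 (Id 1 (U 0) (F 0 A) (F 0 A)) (uaFam (F 0 A) (F 0 A) (consEquiv A a))
      (uaInv (F 0 A) (F 0 A) (consEquiv A a))

def consPath (A a : Raw) : Raw := glob 49 ⬝ A ⬝ a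

/-- The second component of `uaInv`: it records that the chosen identification of types undoes
`cons_a`. -/
def coeConsDef : Def where
  type := pi (U 0) fun A => pi A fun a => pi (F 0 A) fun x =>
    Id 0 (F 0 A) (coe (F 0 A) (F 0 A) (consPath A a) (cons 0 A a ⬝ x)) x
  val := lam fun A => lam fun a =>
    pr2 1 (Id 1 (U 0) (F 0 A) (F 0 A)) (uaFam (F 0 A) (F 0 A) (consEquiv A a))
      (uaInv (F 0 A) (F 0 A) (consEquiv A a))

/-- The loop with index `a`. -/
def loop (A a : Raw) : Path := ⟨W 0 A, north 0 A, north 0 A, loops 0 A a⟩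

/-- The action of the universal cover on the loops. -/
def coverLoops (A : Raw) : Raw :=
  lam fun a => constPath (loop A a) (F 0 A) (F 0 A) (consPath A a)

/-- The universal cover. -/
def coverDef : Def where
  type := pi (U 0) fun A => W 0 A ⇒ U 0
  val := lam fun A =>
    cst (.wedgeElim 0 1) ⬝ A ⬝ (lam fun _ => U 0) ⬝ F 0 A ⬝ coverLoops A

def cover (A : Raw) : Raw := glob 51 ⬝ A

/-- Transport in the universal cover along a loop is inverse to `cons_a`. -/
def coverConsDef : Def where
  type := pi (U 0) fun A => pi A fun a => pi (F 0 A) fun x =>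
    Id 0 (F 0 A) ((loop A a).tr (cover A) (cons 0 A a ⬝ x)) x
  val := lam fun A => lam fun a => lam fun x =>
    let c := cons 0 A a ⬝ x
    let y := coe (F 0 A) (F 0 A) (consPath A a) c
    -- The computation rule of the wedge for loops turns transport in the cover into the action of
    -- `consPath`, which then undoes `cons_a`.
    Path.p <| Path.trans
      ⟨F 0 A, (loop A a).tr (cover A) c, y,
        glob 33 ⬝ W 0 A ⬝ cover A ⬝ north 0 A ⬝ north 0 A ⬝ loops 0 A a ⬝
          consPath A a ⬝ (cst (.wedgeElimLoops 0 1) ⬝ A ⬝ (lam fun _ => U 0) ⬝ F 0 A ⬝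
            coverLoops A ⬝ a) ⬝ c⟩
      ⟨F 0 A, y, x, glob 50 ⬝ A ⬝ a ⬝ x⟩

/-- The total space of the universal cover. -/
def coverTot (A : Raw) : Raw := tot (W 0 A) (cover A)

/-- A point of the total space of the universal cover. -/
def coverPt (A w c : Raw) : Raw := pr (W 0 A) (cover A) w c

/-- The base point of the total space of the universal cover. -/
def coverBase (A : Raw) : Raw := coverPt A (north 0 A) (unit 0 A)

/-- The lift of the loop with index `a` that ends in `x`. -/
def liftLoop (A a x : Raw) : Path :=
  pairPath (cover A) (loop A a) (cons 0 A a ⬝ x) x (glob 52 ⬝ A ⬝ a ⬝ x)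

/-- Each point of the fiber is identified with the base point. -/
def contrFiberDef : Def where
  type := pi (U 0) fun A => pi (F 0 A) fun x =>
    Id 0 (coverTot A) (coverPt A (north 0 A) x) (coverBase A)
  val := lam fun A => glob 48 ⬝ A ⬝
    (lam fun x => Id 0 (coverTot A) (coverPt A (north 0 A) x) (coverBase A)) ⬝
    refl 0 (coverTot A) (coverBase A) ⬝
    -- A contraction path from x is prolonged to one from cons_a x by putting the lifted loop in
    -- front. This operation is an equivalence, so the induction principle applies.
    (lam fun a => lam fun x => lamPath (coverTot A) (coverPt A (north 0 A) x) (coverBase A)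
      fun q => ((liftLoop A a x).trans q).p) ⬝
    (lam fun a => lam fun x => transIsEquiv (liftLoop A a x) (coverBase A))

def contrFiber (A x : Raw) : Path :=
  ⟨coverTot A, coverPt A (north 0 A) x, coverBase A, glob 53 ⬝ A ⬝ x⟩

/-- The hypothesis of `transportPiDef` for the loop with index a. The lift to be compared with ends
at the transported point, with refl as second component. -/
def contrLoopDef : Def where
  type := pi (U 0) fun A => pi A fun a => pi (F 0 A) fun c =>
    let v := (loop A a).tr (cover A) c
    (contrFiber A c).eq
      ((pairPath (cover A) (loop A a) c v (refl 0 (F 0 A) v)).trans (contrFiber A v))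
  val := lam fun A => lam fun a => lam fun c =>
    -- By `mu2` it is enough to treat c = cons_a y. There the contraction computes to the lifted
    -- loop followed by the contraction at y, and `pairPathTransDef` moves the end point from y to
    -- the transport of c.
    let y := icons 0 A a ⬝ c
    transport 0 0 (F 0 A) (fun c =>
        let v := (loop A a).tr (cover A) c
        (contrFiber A c).eq
          ((pairPath (cover A) (loop A a) c v (refl 0 (F 0 A) v)).trans (contrFiber A v)))
      (cons 0 A a ⬝ y) c (mu2 0 A a c)
      (glob 38 ⬝ W 0 A ⬝ cover A ⬝ north 0 A ⬝ north 0 A ⬝ loops 0 A a ⬝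
        (cons 0 A a ⬝ y) ⬝ coverBase A ⬝ (glob 53 ⬝ A) ⬝ y ⬝
        (glob 52 ⬝ A ⬝ a ⬝ y))

/-- The total space of the universal cover is contractible. -/
def contrDef : Def where
  type := pi (U 0) fun A => pi (W 0 A) fun w => pi (cover A ⬝ w) fun c =>
    Id 0 (coverTot A) (coverPt A w c) (coverBase A)
  val := lam fun A => cst (.wedgeElim 0 0) ⬝ A ⬝
    (lam fun w => pi (cover A ⬝ w) fun c => Id 0 (coverTot A) (coverPt A w c) (coverBase A)) ⬝
    (glob 53 ⬝ A) ⬝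
    -- Invariance of the fiberwise contraction under a loop is reduced by `transportPiDef` to the
    -- pointwise equation of `contrLoopDef`.
    (lam fun a => glob 39 ⬝ W 0 A ⬝ cover A ⬝ north 0 A ⬝ north 0 A ⬝ loops 0 A a ⬝
      coverBase A ⬝ (glob 53 ⬝ A) ⬝ (glob 53 ⬝ A) ⬝ (glob 54 ⬝ A ⬝ a))

def contr (A w c : Raw) : Path :=
  ⟨coverTot A, coverPt A w c, coverBase A, glob 55 ⬝ A ⬝ w ⬝ c⟩

/-! ### The equivalence -/

/-- The identification `w = N` given by an element of the universal cover at `w`. -/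
def decodeDef : Def where
  type := pi (U 0) fun A => pi (W 0 A) fun w => cover A ⬝ w ⇒ Id 0 (W 0 A) w (north 0 A)
  val := lam fun A => lam fun w => lam fun c =>
    ((contr A w c).map (W 0 A) (fst (W 0 A) (cover A))).p

/-- By path induction: at refl the contraction is evaluated at unit, where it computes to refl. -/
def decodeTransportDef : Def where
  type := pi (U 0) fun A => pi (W 0 A) fun w => piPath (W 0 A) (north 0 A) w fun q =>
    Id 0 (Id 0 (W 0 A) w (north 0 A)) (glob 56 ⬝ A ⬝ w ⬝ q.tr (cover A) (unit 0 A))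
      q.inv.p
  val := lam fun A => lam fun w => lamPath (W 0 A) (north 0 A) w fun q =>
    q.ind (fun w q => let q : Path := ⟨W 0 A, north 0 A, w, q⟩
      Id 0 (Id 0 (W 0 A) w (north 0 A)) (glob 56 ⬝ A ⬝ w ⬝ q.tr (cover A) (unit 0 A))
        q.inv.p)
      (Path.rfl (W 0 A) (north 0 A)).rfl2

/-- The map from the free higher group to the loop space. -/
def toLoopDef : Def where
  type := pi (U 0) fun A => F 0 A ⇒ loopSpace 0 A
  val := lam fun A => glob 56 ⬝ A ⬝ north 0 A

def toLoop (A : Raw) : Raw := glob 58 ⬝ A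

/-- The inverse sends p to the transport of unit along p⁻¹. One composite is the identity because
the contraction path at x lies over e(x) and joins x to unit (`transportFstDef`). The other one
sends p to p⁻¹⁻¹. -/
def toLoopIsEquivDef : Def where
  type := pi (U 0) fun A => isEquiv (F 0 A) (loopSpace 0 A) (toLoop A)
  val := lam fun A =>
    glob 30 ⬝ F 0 A ⬝ loopSpace 0 A ⬝ toLoop A ⬝
      (lamPath (W 0 A) (north 0 A) (north 0 A) fun p => p.inv.tr (cover A) (unit 0 A)) ⬝
      (lam fun x => let q := contrFiber A x
        glob 40 ⬝ W 0 A ⬝ cover A ⬝ q.x ⬝ q.y ⬝ q.p) ⬝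
      (lamPath (W 0 A) (north 0 A) (north 0 A) fun p => Path.p <| Path.trans
        ⟨loopSpace 0 A, toLoop A ⬝ p.inv.tr (cover A) (unit 0 A), p.inv.inv.p,
          glob 57 ⬝ A ⬝ north 0 A ⬝ p.inv.p⟩
        (invInv p))

/-- `e (cons_a x) = loops a · e x`. -/
def toLoopConsDef : Def where
  type := pi (U 0) fun A => pi A fun a => pi (F 0 A) fun x =>
    Id 0 (loopSpace 0 A) (toLoop A ⬝ (cons 0 A a ⬝ x))
      ((loop A a).trans ⟨W 0 A, north 0 A, north 0 A, toLoop A ⬝ x⟩).p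
  val := lam fun A => lam fun a => lam fun x =>
    -- The contraction at cons_a x computes to p followed by the contraction at x, and p projects to
    -- `loops a`.
    let p := liftLoop A a x
    glob 32 ⬝ coverTot A ⬝ W 0 A ⬝ fst (W 0 A) (cover A) ⬝ p.x ⬝ p.y ⬝ coverBase A ⬝
      p.p ⬝ loops 0 A a ⬝
      (glob 37 ⬝ W 0 A ⬝ cover A ⬝ north 0 A ⬝ north 0 A ⬝ loops 0 A a ⬝
        (cons 0 A a ⬝ x) ⬝ x ⬝ (glob 52 ⬝ A ⬝ a ⬝ x)) ⬝ (contrFiber A x).p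

/-! ### Connectedness -/

/-- The identity types of a set are sets. -/
def isSetIdDef : Def where
  type := pi (U 0) fun X => IsSet 0 X ⇒ pi X fun x => pi X fun y => IsSet 0 (Id 0 X x y)
  val := lam fun X => lam fun s => lam fun x => lam fun y =>
    lamPath X x y fun p => lamPath X x y fun q =>
    -- The set structure gives a path h q from p to every q. Path induction shows that each α from p
    -- to q equals (h p)⁻¹ · h q, so any two agree.
    let h (q : Raw) : Path := ⟨Id 0 X x y, p.p, q, s ⬝ x ⬝ y ⬝ p.p ⬝ q⟩
    let can (α : Path) : Path := ⟨α.type, α.p, ((h p.p).inv.trans (h q.p)).p,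
      α.ind (fun q α => Path.eq ⟨Id 0 X x y, p.p, q, α⟩ ((h p.p).inv.trans (h q)))
        (invTrans (h p.p)).p⟩
    lamPath (Id 0 X x y) p.p q.p fun α => lamPath (Id 0 X x y) p.p q.p fun β =>
      ((can α).trans (can β).inv).p

/-- The wedge of circles is connected. -/
def connectedDef : Def where
  type := pi (U 0) fun A => IsConnected 0 (W 0 A)
  val := lam fun A =>
    let T := Trunc 0 (W 0 A)
    let s := cst (.truncSet 0) ⬝ W 0 A
    let i (w : Raw) : Raw := cst (.truncIn 0) ⬝ W 0 A ⬝ w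
    let c := i (north 0 A)
    pair 0 T (fun c => pi T fun t => Id 0 T c t) c <|
      -- Identity types of the truncation are sets, so only points of the wedge matter. The base
      -- point is the center itself, and the condition at a loop holds because the truncation is a
      -- set.
      cst (.truncElim 0 0) ⬝ W 0 A ⬝ (lam fun t => Id 0 T c t) ⬝
      (lam fun t => glob 61 ⬝ T ⬝ s ⬝ c ⬝ t) ⬝
      (cst (.wedgeElim 0 0) ⬝ A ⬝ (lam fun w => Id 0 T c (i w)) ⬝ refl 0 T c ⬝
        (lam fun a => s ⬝ c ⬝ c ⬝ (loop A a).tr (lam fun w => Id 0 T c (i w)) (refl 0 T c) ⬝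
          refl 0 T c))

/-! ### The theorem -/

/-- The delooping of the free higher group, and its compatibility with the structure. -/
def deloopingType (i : ℕ) : Raw :=
  pi (U i) fun A =>
  Sig i (Delooping i (F i A) (W i A) (north i A)) fun d =>
    let e : Raw := Delooping.map i (F i A) (W i A) (north i A) d
    Times i
      (Id i (loopSpace i A) (e ⬝ unit i A) (refl i (W i A) (north i A)))
      (pi A fun a => pi (F i A) fun x =>
        Id i (loopSpace i A) (e ⬝ (cons i A a ⬝ x))
          (concat i (W i A) (north i A) (north i A) (north i A) (loops i A a) (e ⬝ x)))

/-- The map underlying the constructed delooping computes to `toLoop`, so the structure equations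
can be stated and proved for `toLoop`. -/
def deloopingDef : Def where
  type := deloopingType 0
  val := lam fun A =>
    let Ω := loopSpace 0 A
    pair 0 (Delooping 0 (F 0 A) (W 0 A) (north 0 A)) (fun d =>
        let e : Raw := Delooping.map 0 (F 0 A) (W 0 A) (north 0 A) d
        Times 0 (Id 0 Ω (e ⬝ unit 0 A) (refl 0 (W 0 A) (north 0 A)))
          (pi A fun a => pi (F 0 A) fun x => Id 0 Ω (e ⬝ (cons 0 A a ⬝ x))
            (concat 0 (W 0 A) (north 0 A) (north 0 A) (north 0 A) (loops 0 A a) (e ⬝ x))))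
      (pair 0 (IsConnected 0 (W 0 A)) (fun _ => equiv (F 0 A) Ω) (glob 62 ⬝ A)
        (pair 0 (F 0 A ⇒ Ω) (isEquiv (F 0 A) Ω) (toLoop A) (glob 59 ⬝ A)))
      (pair 0 (Id 0 Ω (toLoop A ⬝ unit 0 A) (refl 0 (W 0 A) (north 0 A)))
        (fun _ => pi A fun a => pi (F 0 A) fun x => Id 0 Ω (toLoop A ⬝ (cons 0 A a ⬝ x))
          ((loop A a).trans ⟨W 0 A, north 0 A, north 0 A, toLoop A ⬝ x⟩).p)
        (Path.rfl (W 0 A) (north 0 A)).rfl2 (glob 60 ⬝ A))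

/-- The definitions, in order. -/
def defs : List Def := [
  proj1Def,
  rest1Def,
  proj2Def,
  rest2Def,
  proj3Def,
  proj4Def,
  invDef,
  transDef,
  apDef,
  trDef,
  invInvDef,
  invTransDef,
  transReflDef,
  cancelRightDef,
  isEquivDef,
  equivDef,
  isEquivInvDef,
  isEquivEtaDef,
  isEquivEpsDef,
  isEquivTauDef,
  idIsEquivDef,
  equivMapDef,
  equivIsEquivDef,
  idEquivDef,
  idToEqDef,
  equivIndDef,
  uaInvDef,
  homotopyDef,
  apHomotopyDef,
  apConjDef,
  adjointifyDef,
  transIsEquivDef,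
  apTransDef,
  transportCoeDef,
  fstDef,
  sndDef,
  pairPathDef,
  apFstDef,
  pairPathTransDef,
  transportPiDef,
  transportFstDef,
  apOverDef,
  invTypeDef,
  etaTypeDef,
  epsTypeDef,
  tauTypeDef,
  invOverDef,
  consEquivDef,
  freeIndDef,
  consPathDef,
  coeConsDef,
  coverDef,
  coverConsDef,
  contrFiberDef,
  contrLoopDef,
  contrDef,
  decodeDef,
  decodeTransportDef,
  toLoopDef,
  toLoopIsEquivDef,
  toLoopConsDef,
  isSetIdDef,
  connectedDef,
  deloopingDef]

/-! ### Validity of the types of the constants -/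

/-- The constants that come before the `r`-th kind, at the levels `0` and `1`. -/
def okBelow (r : ℕ) (c : Cst) : Bool :=
  c.code.1.blt r && (c.code.2.1.ble 1 && c.code.2.2.ble 1)

/-- The type of `c` is accepted by the type checker, with the constants that come before `c`. -/
def checkCst (c : Cst) : Bool :=
  (levelOf [] 1000 (run [] (okBelow c.code.1) 1000) [] c.type).isSome

/-- The constants with one level that are used, at level `i`. -/
def csts₁ (i : ℕ) : List Cst :=
  [.sig i, .pair i, .id i, .refl i, .funext i, .free i, .unit i, .cons i, .icons i,
    .mu1 i, .mu2 i, .mu i, .wedge i, .north i, .loops i, .trunc i, .truncIn i, .truncSet i]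

/-- The constants with two levels that are used, at levels `i` and `j`. -/
def csts₂ (i j : ℕ) : List Cst :=
  [.sigElim i j, .idElim i j, .freeElim i j, .wedgeElim i j, .truncElim i j, .wedgeElimLoops i j]

/-- All constants that are used. -/
def csts : List Cst :=
  .univalence 0 :: csts₁ 0 ++ csts₁ 1 ++ (csts₂ 0 0 ++ csts₂ 0 1 ++ csts₂ 1 0 ++ csts₂ 1 1)

theorem mem_csts {c : Cst} (h : okBelow 25 c) : c ∈ csts := by
  have two {i : ℕ} (h : i ≤ 1) : i = 0 ∨ i = 1 := by omega
  cases c <;> simp [okBelow, Cst.code, Nat.blt_eq, Nat.ble_eq] at h <;>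
    first
      | (rcases two h with rfl | rfl <;> simp [csts, csts₁, csts₂])
      | (obtain ⟨-, rfl⟩ := h; simp [csts])
      | (obtain ⟨h, h'⟩ := h
         rcases two h with rfl | rfl <;> rcases two h' with rfl | rfl <;>
           simp [csts, csts₁, csts₂])

/-- Kernel evaluation of the checker on finitely many types; only the levels 0 and 1 occur. -/
theorem csts_checked : csts.all checkCst = true := by decide +kernel

theorem Sound.nil : Sound [] fun _ => .univ 0 where
  closed _ _ _ := rfl
  val h := by simp [lookup] at h
  hasType h := by simp [lookup] at h
  isType h := by simp [lookup] at h

/-- Soundness of the checker presupposes that the accepted constants have well-formed types.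
Induction on the kind avoids the circle, as each type is checked with constants of smaller kind
only. The bound 25 leaves out the path computation rules of F(A). -/
theorem type_isType {r : ℕ} (hr : r ≤ 25) (c : Cst) (hc : okBelow r c) : IsType [] c.type := by
  induction r generalizing c with
  | zero => simp [okBelow] at hc
  | succ r ih =>
    have ih := ih (by omega)
    have h25 : okBelow 25 c := by
      simp only [okBelow, Bool.and_eq_true, Nat.blt_eq] at hc ⊢
      exact ⟨by omega, hc.2⟩
    by_cases h : okBelow r c
    · exact ih c h
    -- A constant that is new at this stage has kind exactly `r`, so its check used only the
    -- constants covered by the induction hypothesis.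
    · have hr : c.code.1 = r := by
        simp only [okBelow, Bool.and_eq_true, Nat.blt_eq, not_and] at hc h
        by_contra hne
        exact h (by omega) hc.2.1 hc.2.2
      have := List.all_eq_true.1 csts_checked c (mem_csts h25)
      simp only [checkCst, hr, Option.isSome_iff_exists] at this
      obtain ⟨i, hi⟩ := this
      have := levelOf_sound Sound.nil (run_sound Sound.nil ih 1000) (Γ := []) .nil hi
      rw [TypedAt, c.inst_type] at this
      exact ⟨i, this⟩

/-! ### Lists of definitions -/

/-- All definitions that `t` refers to have an index less than `m`. -/
def Tm.inScope (m : ℕ) : Tm → ℕ → Bool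
  | .var n, d => n.blt (d + m)
  | .pi A B, d => A.inScope m d && B.inScope m (d + 1)
  | .lam b, d => b.inScope m (d + 1)
  | .app f a, d => f.inScope m d && a.inScope m d
  | _, _ => true

theorem Tm.inst_congr {m : ℕ} {σ τ : ℕ → Tm} (h : ∀ k < m, σ k = τ k) {t : Tm} {d : ℕ}
    (ht : t.inScope m d) : t.inst σ d = t.inst τ d := by
  induction t generalizing d with
  | var n =>
    simp only [Tm.inScope, Nat.blt_eq] at ht
    simp only [Tm.inst]
    split_ifs
    · rfl
    · exact h _ (by omega)
  | _ => simp_all [Tm.inScope, Tm.inst]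

/-- The type checker with all constants that are used. -/
def check (G : List Entry) : Checker := run G (okBelow 25) 1000

/-- The definition `e` is correct, after the definitions `G`. -/
def checkEntry (G : List Entry) (e : Entry) : Bool :=
  (e.val.inScope G.length 0 && e.type.inScope G.length 0) &&
    ((levelOf G 1000 (check G) [] e.type).isSome && (check G [] e.val (some e.type)).isSome)

/-- The value of the new definition is its body with the old values inserted. Earlier entries refer
only to indices below `G.length`, so their instances do not change. -/
theorem Sound.snoc {G : List Entry} {e : Entry} (he : checkEntry G e)
    (hG : ∀ k e, lookup G k = some e → e.val.inScope G.length 0 ∧ e.type.inScope G.length 0)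
    {σ : ℕ → Tm} (hσ : Sound G σ) :
    Sound (G ++ [e]) (Function.update σ G.length (e.val.inst σ 0)) := by
  set τ := Function.update σ G.length (e.val.inst σ 0) with hτ
  have hστ {k : ℕ} (hk : k < G.length) : τ k = σ k := Function.update_of_ne hk.ne _ _
  have inst {t : Tm} (h : t.inScope G.length 0) : t.inst τ 0 = t.inst σ 0 :=
    Tm.inst_congr (fun k hk => hστ hk) h
  simp only [checkEntry, Bool.and_eq_true, Option.isSome_iff_exists] at he
  obtain ⟨⟨hv, ht⟩, ⟨i, hi⟩, S, hS⟩ := he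
  have hr := run_sound hσ (type_isType le_rfl) 1000
  have hi : HasType [] _ _ := levelOf_sound hσ hr (Γ := []) .nil hi
  have hS : HasType [] _ _ := hr.check (Γ := []) .nil hi hS
  have cases {k : ℕ} {e' : Entry} (h : lookup (G ++ [e]) k = some e') :
      lookup G k = some e' ∧ k < G.length ∨ k = G.length ∧ e' = e := by
    rw [lookup_eq] at h ⊢
    have hk := (List.getElem?_eq_some_iff.1 h).1
    rw [List.length_append, List.length_singleton] at hk
    rcases Nat.lt_succ_iff_lt_or_eq.1 hk with hk | rfl
    · exact .inl ⟨by rwa [List.getElem?_append_left hk] at h, hk⟩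
    · exact .inr ⟨rfl, by simpa using h.symm⟩
  refine ⟨fun k d m => ?_, fun h => ?_, fun h => ?_, fun h => ?_⟩
  · by_cases hk : k = G.length
    · simp only [hτ, hk, Function.update_self]
      exact hS.lift_eq d (Nat.zero_le m)
    · simp only [hτ, Function.update_of_ne hk]; exact hσ.closed k d m
  · rcases cases h with ⟨h, hk⟩ | ⟨rfl, rfl⟩
    · rw [hστ hk, inst (hG _ _ h).1, hσ.val h]
    · rw [inst hv, hτ, Function.update_self]
  · rcases cases h with ⟨h, hk⟩ | ⟨rfl, rfl⟩
    · rw [hστ hk, inst (hG _ _ h).2]; exact hσ.hasType h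
    · rw [inst ht, hτ, Function.update_self]; exact hS
  · rcases cases h with ⟨h, hk⟩ | ⟨rfl, rfl⟩
    · rw [inst (hG _ _ h).2]; exact hσ.isType h
    · rw [inst ht]; exact ⟨i, hi⟩

theorem Tm.inScope_mono {m n : ℕ} (h : m ≤ n) {t : Tm} {d : ℕ} (ht : t.inScope m d) :
    t.inScope n d := by
  induction t generalizing d with
  | var k => simp only [Tm.inScope, Nat.blt_eq] at ht ⊢; omega
  | _ => simp_all [Tm.inScope]

/-- The first definitions of `G` are correct. -/
theorem exists_sound {G : List Entry} {n : ℕ} (hn : n ≤ G.length)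
    (h : ∀ k (hk : k < n), checkEntry (G.take k) (G[k])) : ∃ σ, Sound (G.take n) σ := by
  have inScope : ∀ m ≤ n, ∀ k e, lookup (G.take m) k = some e → e.val.inScope (G.take m).length 0 ∧
      e.type.inScope (G.take m).length 0 := by
    intro m hm k e he
    rw [lookup_eq, List.getElem?_take] at he
    split_ifs at he with hk
    have := h k (by omega)
    rw [(List.getElem?_eq_some_iff.1 he).2] at this
    simp only [checkEntry, Bool.and_eq_true, List.length_take] at this ⊢
    exact ⟨Tm.inScope_mono (by omega) this.1.1, Tm.inScope_mono (by omega) this.1.2⟩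
  induction n with
  | zero => exact ⟨_, Sound.nil⟩
  | succ n ih =>
    obtain ⟨σ, hσ⟩ := ih (by omega) (fun k hk => h k (by omega)) (fun m hm => inScope m (by omega))
    rw [List.take_succ_eq_append_getElem (by omega)]
    exact ⟨_, hσ.snoc (h n (by omega)) (inScope n (by omega))⟩

/-! ### Change of the universe levels -/

/-- Increase the levels of a constant. -/
def Cst.shift (n : ℕ) : Cst → Cst
  | .sig i => .sig (n + i) | .pair i => .pair (n + i) | .sigElim i j => .sigElim (n + i) (n + j)
  | .id i => .id (n + i) | .refl i => .refl (n + i) | .idElim i j => .idElim (n + i) (n + j)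
  | .funext i => .funext (n + i) | .univalence i => .univalence (n + i)
  | .free i => .free (n + i) | .unit i => .unit (n + i) | .cons i => .cons (n + i)
  | .icons i => .icons (n + i)
  | .mu1 i => .mu1 (n + i) | .mu2 i => .mu2 (n + i) | .mu i => .mu (n + i)
  | .freeElim i j => .freeElim (n + i) (n + j)
  | .freeElimMu1 i j => .freeElimMu1 (n + i) (n + j)
  | .freeElimMu2 i j => .freeElimMu2 (n + i) (n + j)
  | .freeElimMu i j => .freeElimMu (n + i) (n + j)
  | .wedge i => .wedge (n + i) | .north i => .north (n + i) | .loops i => .loops (n + i)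
  | .wedgeElim i j => .wedgeElim (n + i) (n + j)
  | .wedgeElimLoops i j => .wedgeElimLoops (n + i) (n + j)
  | .trunc i => .trunc (n + i) | .truncIn i => .truncIn (n + i)
  | .truncSet i => .truncSet (n + i) | .truncElim i j => .truncElim (n + i) (n + j)

/-- Increase all levels in a term. -/
def Tm.shift (n : ℕ) : Tm → Tm
  | .var k => .var k
  | .univ i => .univ (n + i)
  | .pi A B => .pi (A.shift n) (B.shift n)
  | .lam b => .lam (b.shift n)
  | .app f a => .app (f.shift n) (a.shift n)
  | .cst c => .cst (c.shift n)

/-- The types of the constants are uniform in their levels, and n + (i + 1) computes to (n + i) + 1.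
-/
theorem Cst.shift_type (n : ℕ) (c : Cst) : (c.shift n).type = c.type.shift n := by
  cases c <;> rfl

theorem Tm.shift_lift (n : ℕ) (t : Tm) (d k : ℕ) : (t.lift d k).shift n = (t.shift n).lift d k := by
  induction t generalizing k <;> simp_all [Tm.lift, Tm.shift]
  split_ifs <;> rfl

theorem Tm.shift_subst (n : ℕ) (t s : Tm) (k : ℕ) :
    (t.subst s k).shift n = (t.shift n).subst (s.shift n) k := by
  induction t generalizing k <;> simp_all [Tm.subst, Tm.shift]
  split_ifs <;> simp [Tm.shift, Tm.shift_lift]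

theorem Tm.shift_apps (n : ℕ) (f : Tm) (l : List Tm) :
    (f.apps l).shift n = (f.shift n).apps (l.map fun t => t.shift n) := by
  induction l generalizing f with
  | nil => rfl
  | cons a l h => exact h _

theorem Conv.shift (n : ℕ) {s t : Tm} (h : Conv s t) : Conv (s.shift n) (t.shift n) := by
  induction h with
  | refl t => exact .refl _
  | symm _ h => exact h.symm
  | trans _ _ h h' => exact h.trans h'
  | pi _ _ h h' => exact .pi h h'
  | lam _ h => exact .lam h
  | app _ _ h h' => exact .app h h'
  | beta b a => rw [Tm.shift_subst]; exact .beta _ _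
  | eta f =>
    simp only [Tm.shift, Tm.shift_lift]
    exact .eta _
  | _ =>
    simp only [Tm.shift_apps, List.map, Tm.shift, Cst.shift]
    first
      | apply Conv.sigElim
      | apply Conv.idElim
      | apply Conv.freeElim_unit
      | apply Conv.freeElim_cons
      | apply Conv.freeElim_icons
      | apply Conv.wedgeElim
      | apply Conv.truncElim

/-- No rule singles out a level, so a derivation can be translated along the tower of universes.
This reduces the theorem to the lowest universe. -/
theorem HasType.shift (n : ℕ) {Γ : List Tm} {t A : Tm} (h : HasType Γ t A) :
    HasType (Γ.map fun A => A.shift n) (t.shift n) (A.shift n) := by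
  induction h with
  | var h => rw [Tm.shift_lift]; exact .var (by simp [h])
  | univ Γ i => exact .univ _ _
  | cumul _ ih => exact .cumul ih
  | pi _ _ ih ih' => exact .pi ih ih'
  | lam _ _ ih ih' => exact .lam ih ih'
  | app _ _ ih ih' => rw [Tm.shift_subst]; exact .app ih ih'
  | cst Γ c => rw [← c.shift_type]; exact .cst _ _
  | conv _ _ c ih ih' => exact .conv ih ih' (c.shift n)

/-! ### Verification of the library and conclusion. -/

/-- The library, as a list of terms. -/
def library : List Entry := defs.map fun D => ⟨close D.val, close D.type⟩

/-- The definition with index `k` in the library is correct. -/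
def checkIndex (k : ℕ) : Bool := (library[k]?).any (checkEntry (library.take k))


/-- The actual verification of the type-theoretic proof: the kernel runs the checker on each of the
64 definitions, given the earlier ones. -/
theorem library_checked : (List.range 64).all checkIndex = true := by decide +kernel

theorem exists_library : ∃ σ, Sound library σ := by
  have h : library.take 64 = library := rfl
  rw [← h]
  refine exists_sound (Nat.le_of_eq rfl) fun k hk => ?_
  have := List.all_eq_true.1 library_checked k (List.mem_range.2 hk)
  have hk : k < library.length := hk
  rwa [checkIndex, List.getElem?_eq_getElem hk] at this

theorem delooping_zero : IsInhabited (deloopingType 0) := by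
  obtain ⟨σ, hσ⟩ := exists_library
  -- The last definition has index 63. Its type mentions no other definition, so instantiation
  -- leaves it unchanged by computation.
  exact ⟨σ 63, hσ.hasType (k := 63) (e := ⟨close deloopingDef.val, close deloopingDef.type⟩) rfl⟩

end HoTT

theorem mainTheorem6 (i : ℕ) :
    HoTT.IsInhabited (HoTT.pi (HoTT.U i) fun A =>
      HoTT.Sig i (HoTT.Delooping i (HoTT.F i A) (HoTT.W i A) (HoTT.north i A)) fun d =>
        let e : HoTT.Raw := HoTT.Delooping.map i (HoTT.F i A) (HoTT.W i A) (HoTT.north i A) d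
        HoTT.Times i
          (HoTT.Id i (HoTT.loopSpace i A) (HoTT.app e (HoTT.unit i A))
            (HoTT.refl i (HoTT.W i A) (HoTT.north i A)))
          (HoTT.pi A fun a => HoTT.pi (HoTT.F i A) fun x =>
            HoTT.Id i (HoTT.loopSpace i A) (HoTT.app e (HoTT.app (HoTT.cons i A a) x))
              (HoTT.concat i (HoTT.W i A) (HoTT.north i A) (HoTT.north i A) (HoTT.north i A)
                (HoTT.loops i A a) (HoTT.app e x)))) := by
  obtain ⟨t, ht⟩ := HoTT.delooping_zero
  -- Shifting turns level 0 into `i + 0`, which computes to `i`, so the shifted type is the required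
  -- one by computation.
  exact ⟨t.shift i, ht.shift i⟩
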